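/- Let $G$ be a simple and simply connected linear algebraic group over $\mathbb{C}$, $H\subseteq G$ a Cartan subgroup, $\mathfrak h=\operatorname{Lie} H$, $R\subseteq\mathfrak h^*$ the root system of $(G,H)$, $W$ its Weyl group, and $R_s\subseteq R$ the set of short roots, i.e. the roots of minimal length for the $W$-invariant inner product (all roots are short if all have the same length). Let $\rho\colon G\to GL(V)$ be a finite-dimensional irreducible algebraic representation. For $\mu\in\mathfrak h^*$ let $L_\mu=\{v\in V:\rho(\exp X)v=e^{\mu(X)}v\ \text{for all } X\in\mathfrak h\}$, and call $\mu$ a weight of $\rho$ if $L_\mu\neq 0$. In particular, $L_0$ is the subspace of $V$ on which $H$ acts trivially. Assume that $\rho$ is properly quasi-minuscule: any two nonzero weights of $\rho$ are conjugate under $W$, but it is not the case that any two weights of $\rho$ are conjugate under $W$. Then: 1. $\rho(H)$ is equal to the subgroup $\widetilde H$ of $GL(V)$ consisting of all $A$ such that $A|_{L_0}=\operatorname{Id}$ and such that there are nonzero scalars $a_\alpha\in\mathbb{C}^*$, $\alpha\in R_s$, for which $A|_{L_\alpha}$ is multiplication by $a_\alpha$ for every $\alpha\in R_s$, $a_\alpha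 a_{-\alpha}=1$ for every $\alpha\in R_s$, and $a_\alpha a_\beta a_\gamma=1$ for all $(\alpha,\beta,\gamma)\in R_s^3$ with $\alpha+\beta+\gamma=0$. 2. Let $\mathbb{Z}[R_s]$ be the free abelian group with basis $e_\alpha$, $\alpha\in R_s$. The kernel of the homomorphism $\mathbb{Z}[R_s]\to\mathfrak h^*$, $e_\alpha\mapsto\alpha$, is generated by the elements $e_\alpha+e_{-\alpha}$ for $\alpha\in R_s$ and the elements $e_\alpha+e_\beta-e_\gamma$ for $\alpha,\beta,\gamma\in R_s$ with $\alpha+\beta=\gamma$. -/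

import Mathlib

open scoped MatrixGroups

noncomputable section

namespace LinAlgGroup

open MvPolynomial

attribute [local instance 100] LieRing.ofAssociativeRing

variable {n : ℕ}

/-! ### Linear algebraic groups over `ℂ` and their Lie algebras -/

/-- `G` is Zariski closed in `GL_n(ℂ)`: it is cut out by polynomials in the matrix entries. -/
def IsZariskiClosed (G : Subgroup (GL (Fin n) ℂ)) : Prop :=
  ∃ S : Set (MvPolynomial (Fin n × Fin n) ℂ),
    ∀ g : GL (Fin n) ℂ, g ∈ G ↔ ∀ p ∈ S, eval (fun ij => g.1 ij.1 ij.2) p = 0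

/-- The ideal of the polynomials in the matrix entries that vanish on `G`. -/
def vanishingIdeal (G : Subgroup (GL (Fin n) ℂ)) : Ideal (MvPolynomial (Fin n × Fin n) ℂ) where
  carrier := {p | ∀ g ∈ G, eval (fun ij => g.1 ij.1 ij.2) p = 0}
  zero_mem' := by intro g _; simp
  add_mem' := by intro p q hp hq g hg; simp [hp g hg, hq g hg]
  smul_mem' := by intro c p hp g hg; simp [hp g hg]

/-- The left invariant vector field on matrix space given by `X`, as a derivation: it sends the
coordinate matrix `x` to `x * X`. Its value at the identity is the derivative in direction `X`. -/
def leftInvDerivation (X : Matrix (Fin n) (Fin n) ℂ) :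
    Derivation ℂ (MvPolynomial (Fin n × Fin n) ℂ) (MvPolynomial (Fin n × Fin n) ℂ) :=
  mkDerivation ℂ fun ij => ∑ k, C (X k ij.2) * MvPolynomial.X (ij.1, k)

/-- The derivative of the polynomial `p` at the identity matrix in direction `X`. -/
def derivAtOne (X : Matrix (Fin n) (Fin n) ℂ) (p : MvPolynomial (Fin n × Fin n) ℂ) : ℂ :=
  ∑ ij, X ij.1 ij.2 *
    eval (fun kl => (1 : Matrix (Fin n) (Fin n) ℂ) kl.1 kl.2) (pderiv ij p)

lemma derivAtOne_eq (X : Matrix (Fin n) (Fin n) ℂ) (p : MvPolynomial (Fin n × Fin n) ℂ) :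
    derivAtOne X p =
      eval (fun kl => (1 : Matrix (Fin n) (Fin n) ℂ) kl.1 kl.2) (leftInvDerivation X p) := by
  induction p using MvPolynomial.induction_on with
  | C a => simp [derivAtOne]
  | add p q hp hq =>
    rw [map_add, map_add, ← hp, ← hq]
    simp [derivAtOne, mul_add, Finset.sum_add_distrib]
  | mul_X p ij hp =>
    have h1 : derivAtOne X (p * MvPolynomial.X ij) =
        eval (fun kl => (1 : Matrix (Fin n) (Fin n) ℂ) kl.1 kl.2) p * X ij.1 ij.2 +
        (1 : Matrix (Fin n) (Fin n) ℂ) ij.1 ij.2 * derivAtOne X p := by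
      simp only [derivAtOne, Derivation.leibniz, smul_eq_mul, map_add, map_mul, eval_X, mul_add,
        Finset.sum_add_distrib, Finset.mul_sum]
      congr 1
      · rw [Finset.sum_eq_single ij]
        · simp [mul_comm]
        · intro b _ hb
          simp [pderiv_X_of_ne hb.symm]
        · simp
      · exact Finset.sum_congr rfl fun _ _ => by ring
    rw [h1, hp]
    simp [Derivation.leibniz, leftInvDerivation, mkDerivation_X, Matrix.one_apply]

/-- Left translation by the matrix `g` on polynomial functions. -/
def leftTranslate (g : Matrix (Fin n) (Fin n) ℂ) :
    MvPolynomial (Fin n × Fin n) ℂ →ₐ[ℂ] MvPolynomial (Fin n × Fin n) ℂ :=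
  aeval fun ij => ∑ k, C (g ij.1 k) * MvPolynomial.X (k, ij.2)

lemma eval_leftTranslate (g h : Matrix (Fin n) (Fin n) ℂ) (p : MvPolynomial (Fin n × Fin n) ℂ) :
    eval (fun ij => h ij.1 ij.2) (leftTranslate g p) = eval (fun ij => (g * h) ij.1 ij.2) p := by
  have h1 : ((aeval fun ij : Fin n × Fin n => h ij.1 ij.2).comp (leftTranslate g) :
      MvPolynomial (Fin n × Fin n) ℂ →ₐ[ℂ] ℂ) = aeval fun ij => (g * h) ij.1 ij.2 := by
    ext ij
    simp [leftTranslate, Matrix.mul_apply]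
  simpa [aeval_eq_eval] using DFunLike.congr_fun h1 p

lemma leftInvDerivation_leftTranslate (X g : Matrix (Fin n) (Fin n) ℂ)
    (p : MvPolynomial (Fin n × Fin n) ℂ) :
    leftInvDerivation X (leftTranslate g p) = leftTranslate g (leftInvDerivation X p) := by
  induction p using MvPolynomial.induction_on with
  | C a => simp [leftTranslate, MvPolynomial.algebraMap_eq]
  | add p q hp hq => simp [hp, hq]
  | mul_X p ij hp =>
    simp only [map_mul, Derivation.leibniz, smul_eq_mul, hp, map_add]
    congr 2
    simp [leftTranslate, leftInvDerivation, mkDerivation_X, Finset.mul_sum,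
      Derivation.leibniz]
    rw [Finset.sum_comm]
    simp only [mul_left_comm]

lemma leftInvDerivation_lie (X Y : Matrix (Fin n) (Fin n) ℂ) :
    leftInvDerivation ⁅X, Y⁆ = ⁅leftInvDerivation X, leftInvDerivation Y⁆ := by
  apply MvPolynomial.derivation_ext
  intro ij
  simp [leftInvDerivation, mkDerivation_X, Derivation.commutator_apply,
    LieRing.of_associative_ring_bracket, Matrix.mul_apply, Derivation.leibniz, Finset.mul_sum,
    Finset.sum_mul, sub_mul, Finset.sum_sub_distrib]
  rw [Finset.sum_comm, Finset.sum_comm (f := fun x i => C (Y x i) * _ * _)]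
  simp only [mul_left_comm, mul_assoc]

lemma leftInvDerivation_mem {G : Subgroup (GL (Fin n) ℂ)} {X : Matrix (Fin n) (Fin n) ℂ}
    (hX : ∀ p ∈ vanishingIdeal G, derivAtOne X p = 0) {p : MvPolynomial (Fin n × Fin n) ℂ}
    (hp : p ∈ vanishingIdeal G) : leftInvDerivation X p ∈ vanishingIdeal G := by
  intro g hg
  have h1 : leftTranslate g.1 p ∈ vanishingIdeal G := by
    intro h hh
    rw [eval_leftTranslate]
    exact hp (g * h) (G.mul_mem hg hh)
  have h2 := hX _ h1
  rw [derivAtOne_eq, leftInvDerivation_leftTranslate, eval_leftTranslate, mul_one] at h2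
  exact h2

/-- The Lie algebra of `G`: the tangent space at the identity, with the commutator bracket. -/
def lieAlg (G : Subgroup (GL (Fin n) ℂ)) : LieSubalgebra ℂ (Matrix (Fin n) (Fin n) ℂ) where
  carrier := {X | ∀ p ∈ vanishingIdeal G, derivAtOne X p = 0}
  zero_mem' := by intro p _; simp [derivAtOne]
  add_mem' := by
    intro X Y hX hY p hp
    have h1 := hX p hp
    have h2 := hY p hp
    simp only [derivAtOne, Matrix.add_apply, add_mul, Finset.sum_add_distrib] at *
    rw [h1, h2, add_zero]
  smul_mem' := by
    intro c X hX p hp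
    have h1 := hX p hp
    simp only [derivAtOne, Matrix.smul_apply, smul_eq_mul, mul_assoc, ← Finset.mul_sum] at *
    rw [h1, mul_zero]
  lie_mem' := by
    intro X Y hX hY p hp
    have h1 := hX _ (leftInvDerivation_mem hY hp)
    have h2 := hY _ (leftInvDerivation_mem hX hp)
    rw [derivAtOne_eq] at h1 h2 ⊢
    rw [leftInvDerivation_lie, Derivation.commutator_apply, map_sub, h1, h2, sub_zero]

variable {G : Subgroup (GL (Fin n) ℂ)}

/-- For a subgroup `H` of `G`, the Lie algebra of `H` inside the Lie algebra of `G`. -/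
def lieSub (H : Subgroup G) : LieSubalgebra ℂ (lieAlg G) :=
  (lieAlg (H.map G.subtype)).comap (lieAlg G).incl

/-- `H` is a Cartan subgroup of `G`: a connected (in the classical topology) Zariski closed
subgroup whose Lie algebra is a Cartan subalgebra of the Lie algebra of `G`. -/
class IsCartanSubgroup (H : Subgroup G) : Prop where
  isZariskiClosed : IsZariskiClosed (H.map G.subtype)
  isConnected : IsConnected (H : Set G)
  isCartanSubalgebra : (lieSub H).IsCartanSubalgebra

attribute [instance] IsCartanSubgroup.isCartanSubalgebra

/-! ### Representations and weights -/

section Representation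

variable {V : Type*} [AddCommGroup V] [Module ℂ V]

/-- `ρ` is a morphism of algebraic groups: each of its matrix coefficients is a regular function,
that is, a polynomial in the entries of `g` divided by a power of `det g`. -/
def IsRegularRep (ρ : Representation ℂ G V) : Prop :=
  ∀ (v : V) (φ : Module.Dual ℂ V), ∃ (p : MvPolynomial (Fin n × Fin n) ℂ) (k : ℕ),
    ∀ g : G, φ (ρ g v) = eval (fun ij => g.1.1 ij.1 ij.2) p / g.1.1.det ^ k

/-- The weight space of `μ : 𝔥 → ℂ`: the vectors on which `H` acts through the character with
differential `μ`, which is `exp X ↦ exp (μ X)` for `X ∈ 𝔥`. -/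
def weightSpace (ρ : Representation ℂ G V) (H : Subgroup G) (μ : Module.Dual ℂ (lieSub H)) :
    Submodule ℂ V where
  carrier := {v | ∀ h ∈ H, ∀ X : lieSub H,
    h.1.1 = NormedSpace.exp ((X : lieAlg G) : Matrix (Fin n) (Fin n) ℂ) →
      ρ h v = Complex.exp (μ X) • v}
  zero_mem' := by intro h _ X _; simp
  add_mem' := by intro v w hv hw h hh X hX; simp [hv h hh X hX, hw h hh X hX]
  smul_mem' := by
    intro c v hv h hh X hX
    rw [map_smul, hv h hh X hX, smul_comm]

/-- The weights of `ρ` with respect to `H`. -/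
def weights (ρ : Representation ℂ G V) (H : Subgroup G) : Set (Module.Dual ℂ (lieSub H)) :=
  {μ | weightSpace ρ H μ ≠ ⊥}

end Representation

/-! ### Roots, quasi-minuscule representations and the torus given by short roots -/

variable [LieAlgebra.IsSimple ℂ (lieAlg G)]

/-- The root system of `G` with respect to `H`. -/
abbrev rootSys (H : Subgroup G) [IsCartanSubgroup H] :
    RootPairing (lieSub H).root ℂ (Module.Dual ℂ (lieSub H)) (lieSub H) :=
  LieAlgebra.IsKilling.rootSystem (lieSub H)

/-- The short roots: the roots of minimal length for the Weyl-invariant inner product. (If all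
roots have the same length, then all of them are short.) -/
def shortRoots (H : Subgroup G) [IsCartanSubgroup H] : Set (Module.Dual ℂ (lieSub H)) :=
  {α | ∃ i, (rootSys H).root i = α ∧
    ∀ j, ((rootSys H).posRootForm ℤ).rootLength i ≤ ((rootSys H).posRootForm ℤ).rootLength j}

variable {V : Type*} [AddCommGroup V] [Module ℂ V]

/-- Any two weights are conjugate under the Weyl group. -/
def IsMinuscule (ρ : Representation ℂ G V) (H : Subgroup G) [IsCartanSubgroup H] : Prop :=
  ∀ μ₁ ∈ weights ρ H, ∀ μ₂ ∈ weights ρ H, ∃ w : (rootSys H).weylGroup, w • μ₁ = μ₂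

/-- Any two nonzero weights are conjugate under the Weyl group. -/
def IsQuasiMinuscule (ρ : Representation ℂ G V) (H : Subgroup G) [IsCartanSubgroup H] : Prop :=
  ∀ μ₁ ∈ weights ρ H, μ₁ ≠ 0 → ∀ μ₂ ∈ weights ρ H, μ₂ ≠ 0 →
    ∃ w : (rootSys H).weylGroup, w • μ₁ = μ₂

/-- Quasi-minuscule but not minuscule. -/
def IsProperlyQuasiMinuscule (ρ : Representation ℂ G V) (H : Subgroup G) [IsCartanSubgroup H] :
    Prop :=
  IsQuasiMinuscule ρ H ∧ ¬ IsMinuscule ρ H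

/-- The subgroup of `GL(V)` of the operators that are the identity on the space `L₀` of
`H`-invariants, are multiplication by a nonzero scalar `a α` on `L_α` for each short root `α`, and
satisfy `a α * a (-α) = 1`, and `a α * a β * a γ = 1` whenever `α + β + γ = 0`. -/
def shortRootTorus (ρ : Representation ℂ G V) (H : Subgroup G) [IsCartanSubgroup H] :
    Subgroup (LinearMap.GeneralLinearGroup ℂ V) where
  carrier := {A |
    (∀ v ∈ Representation.invariants (ρ.comp H.subtype), A.1 v = v) ∧
    ∃ a : shortRoots H → ℂˣ,
      (∀ α : shortRoots H, ∀ v ∈ weightSpace ρ H α, A.1 v = (a α : ℂ) • v) ∧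
      (∀ α β : shortRoots H, (β : Module.Dual ℂ (lieSub H)) = -α → a α * a β = 1) ∧
      (∀ α β γ : shortRoots H, (α + β + γ : Module.Dual ℂ (lieSub H)) = 0 →
        a α * a β * a γ = 1)}
  one_mem' := ⟨by simp, 1, by simp, by simp, by simp⟩
  mul_mem' := by
    rintro A B ⟨hA, a, ha1, ha2, ha3⟩ ⟨hB, b, hb1, hb2, hb3⟩
    refine ⟨fun v hv => ?_, a * b, fun α v hv => ?_, fun α β h => ?_, fun α β γ h => ?_⟩
    · simp [hA v hv, hB v hv]
    · simp [ha1 α v hv, hb1 α v hv, smul_smul, mul_comm]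
    · simp only [Pi.mul_apply]
      rw [mul_mul_mul_comm, ha2 α β h, hb2 α β h, one_mul]
    · simp only [Pi.mul_apply]
      rw [mul_mul_mul_comm (a α), mul_mul_mul_comm, ha3 α β γ h, hb3 α β γ h, one_mul]
  inv_mem' := by
    rintro A ⟨hA, a, ha1, ha2, ha3⟩
    have key : ∀ w, A⁻¹.1 (A.1 w) = w := fun w => by
      rw [← Module.End.mul_apply, ← Units.val_mul, inv_mul_cancel]; rfl
    refine ⟨fun v hv => ?_, a⁻¹, fun α v hv => ?_, fun α β h => ?_, fun α β γ h => ?_⟩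
    · conv_lhs => rw [← hA v hv]
      exact key v
    · have h1 : A.1 (((a α)⁻¹ : ℂˣ).1 • v) = v := by
        rw [map_smul, ha1 α v hv, smul_smul, ← Units.val_mul, inv_mul_cancel]; simp
      conv_lhs => rw [← h1]
      exact key _
    · simp only [Pi.inv_apply]
      rw [← mul_inv, ha2 α β h, inv_one]
    · simp only [Pi.inv_apply]
      rw [← mul_inv, ← mul_inv, ha3 α β γ h, inv_one]

/-- The homomorphism `ℤ[R_s] → 𝔥^*` that sends the basis vector `e_α` to `α`. -/
def shortRootMap (H : Subgroup G) [IsCartanSubgroup H] :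
    (shortRoots H →₀ ℤ) →ₗ[ℤ] Module.Dual ℂ (lieSub H) :=
  Finsupp.linearCombination ℤ fun α : shortRoots H => (α : Module.Dual ℂ (lieSub H))

end LinAlgGroup

end

/-! Write 𝔤 and 𝔥 for the Lie algebras of `G` and `H`. For a root system with a base `s`, every
positive root outside `s` is a sum of two positive roots of smaller height. So, modulo the relations
of length two and three, each `e_i` is an integral combination of the `e_j` with `j ∈ s`
(`RootPairing.exists_linearIndepOn_forall_single_mem`). As `s` is independent, these relations
generate all relations. For the same reason a family of nonzero scalars satisfying them is
determined by its values on `s`; taking logarithms there shows that it has the form `α ↦ exp (α X)`.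
Both facts apply to the short roots, which form a root system themselves: reflections preserve
length, and an orbit of the Weyl group spans. This gives part 2.

For part 1, the weights of `ρ` have to be identified (`eq_zero_or_mem_shortRoots_of_mem_weights`).
Being properly quasi-minuscule, `ρ` has the weight 0 and a nonzero weight, so by irreducibility some
root is a weight. Were that root long, subtracting a suitable short root would give a short root
that is a weight, conjugate to the long one, which is absurd. Hence all nonzero weights are short
roots. Since `V` is the sum of its weight spaces, an element of the torus with scalars `exp (α X)`
equals `ρ (exp X)`. The converse inclusion holds because `H = exp 𝔥`.

The passage between groups and Lie algebras rests on the closed subgroup theorem and on the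
differential of `ρ`, both proved below. -/

section RootSystems

open Set Submodule Module

/-! ### Integral relations between roots -/

section RootCombinatorics

/-- The span of the relations `e_i + e_j` for `v j = -v i` and `e_i + e_j - e_k` for
`v i + v j = v k`. -/
noncomputable def additiveRelations {ι M : Type*} [AddCommGroup M] (v : ι → M) :
    Submodule ℤ (ι →₀ ℤ) :=
  span ℤ ({x | ∃ i j, v j = -v i ∧ x = Finsupp.single i 1 + Finsupp.single j 1} ∪
    {x | ∃ i j k, v i + v j = v k ∧
      x = Finsupp.single i 1 + Finsupp.single j 1 - Finsupp.single k 1})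

lemma additiveRelations_le_ker {ι M : Type*} [AddCommGroup M] (v : ι → M) :
    additiveRelations v ≤ LinearMap.ker (Finsupp.linearCombination ℤ v) := by
  refine span_le.mpr ?_
  rintro x (⟨i, j, h, rfl⟩ | ⟨i, j, k, h, rfl⟩) <;> simp [h]

/-- The set `s` is the base of the roots that are positive for a generic functional and
indecomposable among these. The rest is induction on the value of the functional. The statement is
used twice: for relations in `M` and for relations in `ℂˣ`. -/
lemma RootPairing.exists_linearIndepOn_forall_single_mem {ι K M N : Type*} [Finite ι] [Field K]
    [CharZero K] [AddCommGroup M] [Module K M] [AddCommGroup N] [Module K N]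
    (P : RootPairing ι K M N) [P.IsRootSystem] [P.IsCrystallographic] :
    ∃ s : Set ι, LinearIndepOn K P.root s ∧
      ∀ i, Finsupp.single i 1 ∈ additiveRelations P.root ⊔ Finsupp.supported ℤ ℤ s := by
  -- `K` need not be ordered; positivity is tested by a functional with rational values.
  let _i : Module ℚ M := Module.compHom M (algebraMap ℚ K)
  obtain ⟨f, hf⟩ : ∃ f : Dual ℚ M, ∀ i, f (P.root i) ≠ 0 :=
    exists_dual_forall_apply_ne_zero P.root <| by simp [P.ne_zero]
  refine ⟨_, P.linearIndepOn_root_baseOf (f : M →+ ℚ) hf, ?_⟩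
  set S := IsAddIndecomposable.baseOf P.root (f : M →+ ℚ) with hS
  set U := additiveRelations P.root ⊔ Finsupp.supported ℤ ℤ S with hU
  have pos : ∀ i, 0 < f (P.root i) → Finsupp.single i 1 ∈ U := by
    by_contra! hcon
    let t : Set ι := {i | 0 < f (P.root i) ∧ Finsupp.single i (1 : ℤ) ∉ U}
    -- A counterexample of least height is decomposable, and its two summands have smaller height.
    obtain ⟨i, hi⟩ := t.toFinite.exists_minimalFor (f ∘ P.root) t hcon
    have hit : i ∈ t := hi.prop
    have hiS : i ∉ S := fun h => hit.2 <| (le_sup_right : _ ≤ U) <|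
      Finsupp.single_mem_supported ℤ 1 h
    obtain ⟨j, k, hj, hk, hjk⟩ : ∃ j k, 0 < f (P.root j) ∧ 0 < f (P.root k) ∧
        P.root i = P.root j + P.root k := by
      by_contra! h
      exact hiS ⟨hit.1, fun j hj k hk h' => absurd h' (h j k hj hk)⟩
    have small : ∀ l, 0 < f (P.root l) → f (P.root l) < f (P.root i) →
        Finsupp.single l (1 : ℤ) ∈ U := by
      intro l hl hli
      by_contra hl'
      exact not_le.mpr hli <| hi.le_of_le (j := l) ⟨hl, hl'⟩ hli.le
    have hfi : f (P.root i) = f (P.root j) + f (P.root k) := by rw [hjk, map_add]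
    have h1 := small j hj (by linarith)
    have h2 := small k hk (by linarith)
    have h3 : Finsupp.single j (1 : ℤ) + Finsupp.single k 1 - Finsupp.single i 1 ∈ U :=
      (le_sup_left : additiveRelations P.root ≤ U) <|
        subset_span <| Or.inr ⟨j, k, i, hjk.symm, rfl⟩
    exact hit.2 ((U.sub_mem_iff_right (U.add_mem h1 h2)).mp h3)
  intro i
  rcases (hf i).lt_or_gt with h | h
  · have hr : P.root (P.reflectionPerm i i) = -P.root i := by simp
    have h1 := pos (P.reflectionPerm i i) (by rw [hr, map_neg]; linarith)
    have h2 : Finsupp.single i (1 : ℤ) + Finsupp.single (P.reflectionPerm i i) 1 ∈ U :=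
      (le_sup_left : additiveRelations P.root ≤ U) <|
        subset_span <| Or.inl ⟨i, _, hr, rfl⟩
    exact (U.add_mem_iff_left h1).mp h2
  · exact pos i h

/-- The relations between roots are generated by those of length two and three. -/
lemma RootPairing.ker_linearCombination_root {ι K M N : Type*} [Finite ι] [Field K]
    [CharZero K] [AddCommGroup M] [Module K M] [AddCommGroup N] [Module K N]
    (P : RootPairing ι K M N) [P.IsRootSystem] [P.IsCrystallographic] :
    LinearMap.ker (Finsupp.linearCombination ℤ P.root) = additiveRelations P.root := by
  refine le_antisymm (fun x hx => ?_) (additiveRelations_le_ker _)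
  obtain ⟨s, hs, hsup⟩ := P.exists_linearIndepOn_forall_single_mem
  have htop : additiveRelations P.root ⊔ Finsupp.supported ℤ ℤ s = ⊤ := by
    rw [eq_top_iff, ← Finsupp.supported_univ, Finsupp.supported_eq_span_single, span_le]
    rintro - ⟨i, -, rfl⟩
    exact hsup i
  obtain ⟨r, hr, y, hy, rfl⟩ := mem_sup.mp (htop ▸ mem_top : x ∈ _)
  have hy0 : Finsupp.linearCombination ℤ P.root y = 0 := by
    have := additiveRelations_le_ker _ hr
    simpa [LinearMap.mem_ker.mp this] using hx
  -- Modulo the relations `x` equals `y`, which is supported on the independent set `s`.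
  have : y = 0 := linearIndepOn_iff.mp (hs.restrict_scalars' ℤ) y hy hy0
  simpa [this] using hr

/-- A family of nonzero complex numbers that satisfies the relations of length two and three
between the roots is the exponential of a linear functional. -/
lemma RootPairing.exists_dual_exp_eq {ι M N : Type*} [Finite ι]
    [AddCommGroup M] [Module ℂ M] [AddCommGroup N] [Module ℂ N]
    (P : RootPairing ι ℂ M N) [P.IsRootSystem] [P.IsCrystallographic] (a : ι → ℂˣ)
    (h₁ : ∀ i j, P.root j = -P.root i → a i * a j = 1)
    (h₂ : ∀ i j k, P.root i + P.root j = P.root k → a i * a j = a k) :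
    ∃ f : Dual ℂ M, ∀ i, Complex.exp (f (P.root i)) = a i := by
  obtain ⟨s, hs, hsup⟩ := P.exists_linearIndepOn_forall_single_mem
  obtain ⟨f, hf⟩ : ∃ f : Dual ℂ M, ∀ i ∈ s, f (P.root i) = Complex.log (a i) := by
    obtain ⟨f, hf⟩ := LinearMap.exists_extend
      (Finsupp.linearCombination ℂ (fun i : s => Complex.log (a i)) ∘ₗ
        LinearIndependent.repr hs)
    refine ⟨f, fun i hi => ?_⟩
    have h := LinearMap.congr_fun hf ⟨P.root i, subset_span ⟨⟨i, hi⟩, rfl⟩⟩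
    have h' : LinearIndependent.repr hs ⟨P.root i, subset_span ⟨⟨i, hi⟩, rfl⟩⟩ =
      Finsupp.single ⟨i, hi⟩ 1 := LinearIndependent.repr_eq_single hs _ _ rfl
    simpa [h'] using h
  refine ⟨f, fun i => ?_⟩
  -- The quotient `a / b` respects the relations and is trivial on `s`, so it is trivial on every
  -- root.
  let b : ι → ℂˣ := fun i => Units.mk0 _ (Complex.exp_ne_zero (f (P.root i)))
  let c : ι → Additive ℂˣ := fun i => Additive.ofMul (a i / b i)
  suffices h : Finsupp.single i 1 ∈ LinearMap.ker (Finsupp.linearCombination ℤ c) by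
    have h1 : c i = 0 := by simpa using h
    rw [div_eq_one.mp (ofMul_eq_zero.mp h1)]
    rfl
  have hb : ∀ i j k, P.root i + P.root j = P.root k → b i * b j = b k := fun i j k h => by
    ext; simp [b, ← h, Complex.exp_add]
  have hb' : ∀ i j, P.root j = -P.root i → b i * b j = 1 := fun i j h => by
    ext; simp [b, h, ← Complex.exp_add]
  refine (?_ : _ ⊔ _ ≤ LinearMap.ker (Finsupp.linearCombination ℤ c)) (hsup i)
  refine sup_le (span_le.mpr ?_) ?_
  · rintro x (⟨i, j, h, rfl⟩ | ⟨i, j, k, h, rfl⟩)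
    · simp only [SetLike.mem_coe, LinearMap.mem_ker, map_add, Finsupp.linearCombination_single,
        one_smul, c, ← ofMul_mul]
      rw [div_mul_div_comm, h₁ i j h, hb' i j h, div_one, ofMul_one]
    · simp only [SetLike.mem_coe, LinearMap.mem_ker, map_add, map_sub,
        Finsupp.linearCombination_single, one_smul, c, ← ofMul_mul]
      rw [div_mul_div_comm, h₂ i j k h, hb i j k h, sub_self]
  · rw [Finsupp.supported_eq_span_single, span_le]
    rintro - ⟨j, hj, rfl⟩
    have : a j = b j := by
      ext; simp [b, hf j hj, Complex.exp_log]
    simp [c, this]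

/-- A spanning set of roots of a root system that is stable under its own reflections is again a
root system. -/
lemma RootPairing.exists_subsystem {ι K M N : Type*} [Finite ι] [Field K]
    [CharZero K] [AddCommGroup M] [Module K M] [AddCommGroup N] [Module K N]
    (P : RootPairing ι K M N) [P.IsCrystallographic] (T : Set M) (hT : T ⊆ range P.root)
    (hrefl : ∀ i, P.root i ∈ T → ∀ x ∈ T, P.reflection i x ∈ T) (hspan : span K T = ⊤) :
    ∃ Q : RootPairing T K M N, Q.IsRootSystem ∧ Q.IsCrystallographic ∧ ∀ x, Q.root x = x := by
  choose idx hidx using fun x : T => hT x.2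
  have : Finite T := .of_injective idx fun x y h => Subtype.ext <| by rw [← hidx, ← hidx, h]
  have hinj : Function.Injective (fun x : T => P.coroot (idx x)) := fun x y h =>
    Subtype.ext <| by rw [← hidx, ← hidx, P.coroot.injective h]
  let r : T ↪ M := Function.Embedding.subtype _
  let c : T ↪ N := ⟨fun x => P.coroot (idx x), hinj⟩
  have hp : ∀ x, P.toLinearMap (r x) (c x) = 2 := fun x => by
    have : r x = P.root (idx x) := (hidx x).symm
    rw [this]; exact P.root_coroot_two _
  have hs : ∀ x, MapsTo (preReflection (r x) (P.toLinearMap.flip (c x))) (range r) (range r) := by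
    rintro x - ⟨y, rfl⟩
    have h := hrefl (idx x) (by rw [hidx]; exact x.2) y y.2
    refine ⟨⟨_, h⟩, ?_⟩
    have hx : r x = P.root (idx x) := (hidx x).symm
    simp [hx, r, c, preReflection_apply, RootPairing.reflection_apply, RootPairing.coroot']
  have hsp : span K (range r) = ⊤ := by simpa [r] using hspan
  have hint : ∀ x y, ∃ z : ℤ, z = P.toLinearMap (r x) (c y) := fun x y => by
    have hx : r x = P.root (idx x) := (hidx x).symm
    rw [hx]
    exact P.exists_value (idx x) (idx y)
  exact ⟨RootPairing.mk'' P.toLinearMap r c hp hs hsp, RootPairing.isRootSystem_mk'' hint,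
    ⟨hint⟩, fun x => rfl⟩

end RootCombinatorics

end RootSystems

/-! ### The root system of short roots -/

section ShortRoots

open Set Submodule Module

section RootLength

variable {ι K M N : Type*} [Fintype ι] [Field K] [CharZero K] [AddCommGroup M] [Module K M]
  [AddCommGroup N] [Module K N] (P : RootPairing ι K M N) [P.IsCrystallographic]

lemma RootPairing.rootLength_posRootForm_eq_iff (i j : ι) :
    (P.posRootForm ℤ).rootLength i = (P.posRootForm ℤ).rootLength j ↔
      P.RootForm (P.root i) (P.root i) = P.RootForm (P.root j) (P.root j) := by
  rw [← (algebraMap ℤ K).injective_int.eq_iff, RootPositiveForm.algebraMap_rootLength,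
    RootPositiveForm.algebraMap_rootLength]
  rfl

lemma RootPairing.rootLength_posRootForm_weylGroup (w : P.weylGroup) (i : ι) :
    (P.posRootForm ℤ).rootLength (P.weylGroupToPerm w i) = (P.posRootForm ℤ).rootLength i := by
  rw [P.rootLength_posRootForm_eq_iff, ← P.weylGroup_apply_root]
  exact InvariantForm.apply_weylGroup_smul P (B := (P.posRootForm ℤ).toInvariantForm) w _ _

lemma RootPairing.rootLength_posRootForm_reflectionPerm (i j : ι) :
    (P.posRootForm ℤ).rootLength (P.reflectionPerm i j) = (P.posRootForm ℤ).rootLength j := by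
  rw [P.rootLength_posRootForm_eq_iff, P.root_reflectionPerm]
  exact P.rootForm_reflection_reflection_apply i _ _

/-- A root of an irreducible root system that is strictly longer than some root is the sum of two
roots of the length of the latter. -/
lemma RootPairing.exists_root_sub_root_of_rootLength_lt [P.IsIrreducible] {i l : ι}
    (h : (P.posRootForm ℤ).rootLength l < (P.posRootForm ℤ).rootLength i) :
    ∃ j k, (P.posRootForm ℤ).rootLength j = (P.posRootForm ℤ).rootLength l ∧
      (P.posRootForm ℤ).rootLength k = (P.posRootForm ℤ).rootLength l ∧
      0 < P.pairingIn ℤ i j ∧ P.root i - P.root j = P.root k := by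
  -- Irreducibility gives a root of the length of `l` not orthogonal to `i`; its sign is changed if
  -- necessary.
  have key : ∃ j, (P.posRootForm ℤ).rootLength j = (P.posRootForm ℤ).rootLength l ∧
      0 < P.pairingIn ℤ i j := by
    obtain ⟨j, hj, hij⟩ :=
      P.exists_form_eq_form_and_form_ne_zero (P.posRootForm ℤ).toInvariantForm i l
    have hj' := (P.rootLength_posRootForm_eq_iff j l).mpr hj
    have hij' : P.pairingIn ℤ i j ≠ 0 := by
      rw [Ne, InvariantForm.apply_root_root_zero_iff, ← P.algebraMap_pairingIn ℤ] at hij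
      simpa using hij
    rcases hij'.lt_or_gt with h0 | h0
    · refine ⟨P.reflectionPerm j j, by rw [RootPositiveForm.rootLength_reflectionPerm_self, hj'], ?_⟩
      simpa using h0
    · exact ⟨j, hj', h0⟩
  obtain ⟨j, hj, hij⟩ := key
  have h1 := (P.posRootForm ℤ).pairingIn_mul_eq_pairingIn_mul_swap i j
  have h2 : 0 < P.pairingIn ℤ j i := (P.zero_lt_pairingIn_iff' ℤ).mp hij
  have h3 := P.pairingIn_pairingIn_mem_set_of_isCrystallographic i j
  have h4 := (P.posRootForm ℤ).rootLength_pos j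
  -- Of two positive pairing integers, the one against the longer root is the smaller, and the
  -- crystallographic list forces it to be 1.
  have h5 : P.pairingIn ℤ j i = 1 := by
    have h6 : P.pairingIn ℤ j i < P.pairingIn ℤ i j := by nlinarith
    simp only [mem_insert_iff, mem_singleton_iff, Prod.mk.injEq] at h3
    omega
  -- As `⟨j, i⟩ = 1`, the difference `i - j` is the reflection of `-j` in `i`, hence has the length
  -- of `j`.
  refine ⟨j, P.reflectionPerm i (P.reflectionPerm j j), hj, ?_, hij, ?_⟩
  · rw [P.rootLength_posRootForm_reflectionPerm, RootPositiveForm.rootLength_reflectionPerm_self, hj]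
  · have h6 : P.pairing j i = 1 := by rw [← P.algebraMap_pairingIn ℤ, h5]; simp
    rw [P.root_reflectionPerm, P.root_reflectionPerm, RootPairing.reflection_apply_self, map_neg,
      P.reflection_apply_root, h6]
    simp

end RootLength

namespace LinAlgGroup

variable {n : ℕ} {G : Subgroup (GL (Fin n) ℂ)} [LieAlgebra.IsSimple ℂ (lieAlg G)]
  (H : Subgroup G) [IsCartanSubgroup H]

lemma shortRoots_subset : shortRoots H ⊆ range (rootSys H).root := by
  rintro - ⟨i, rfl, -⟩; exact ⟨i, rfl⟩

lemma exists_shortRoot : ∃ l, (rootSys H).root l ∈ shortRoots H := by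
  have : Nonempty (lieSub H).root := by
    by_contra! h
    have h1 := RootPairing.IsRootSystem.span_root_eq_top (P := rootSys H)
    have := RootPairing.IsIrreducible.nontrivial (P := rootSys H)
    simp [range_eq_empty] at h1
  obtain ⟨l, hl⟩ := Finite.exists_min ((rootSys H).posRootForm ℤ).rootLength
  exact ⟨l, l, rfl, hl⟩

/-- Comparison with one fixed short root reduces invariance of the short roots to invariance of
length. -/
lemma root_mem_shortRoots_iff {i l : (lieSub H).root} (hl : (rootSys H).root l ∈ shortRoots H) :
    (rootSys H).root i ∈ shortRoots H ↔
      ((rootSys H).posRootForm ℤ).rootLength i = ((rootSys H).posRootForm ℤ).rootLength l := by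
  obtain ⟨l', hl', hl⟩ := hl
  obtain rfl := (rootSys H).root.injective hl'
  constructor
  · rintro ⟨i', hi', hi⟩
    obtain rfl := (rootSys H).root.injective hi'
    exact le_antisymm (hi _) (hl _)
  · exact fun h => ⟨i, rfl, h ▸ hl⟩

lemma weylGroup_smul_mem_shortRoots (w : (rootSys H).weylGroup) {α : Dual ℂ (lieSub H)}
    (hα : α ∈ shortRoots H) : w • α ∈ shortRoots H := by
  obtain ⟨i, rfl⟩ := shortRoots_subset H hα
  rw [RootPairing.weylGroup_apply_root, root_mem_shortRoots_iff H hα]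
  exact RootPairing.rootLength_posRootForm_weylGroup _ w i

lemma reflection_mem_shortRoots (i : (lieSub H).root) {α : Dual ℂ (lieSub H)}
    (hα : α ∈ shortRoots H) : (rootSys H).reflection i α ∈ shortRoots H := by
  obtain ⟨j, rfl⟩ := shortRoots_subset H hα
  rw [← RootPairing.root_reflectionPerm, root_mem_shortRoots_iff H hα]
  exact RootPairing.rootLength_posRootForm_reflectionPerm _ i j

/-- The short roots form a root system. -/
lemma exists_rootPairing_shortRoots :
    ∃ Q : RootPairing (shortRoots H) ℂ (Dual ℂ (lieSub H)) (lieSub H),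
      Q.IsRootSystem ∧ Q.IsCrystallographic ∧ ∀ α, Q.root α = α := by
  refine (rootSys H).exists_subsystem _ (shortRoots_subset H)
    (fun i _ α hα => reflection_mem_shortRoots H i hα) ?_
  obtain ⟨l, hl⟩ := exists_shortRoot H
  -- By irreducibility the Weyl orbit of a single short root already spans.
  rw [eq_top_iff, ← RootPairing.span_orbit_eq_top (P := rootSys H) l]
  refine span_mono ?_
  rintro - ⟨w, rfl⟩
  exact weylGroup_smul_mem_shortRoots H w hl

lemma ker_shortRootMap :
    LinearMap.ker (shortRootMap H) =
      additiveRelations fun α : shortRoots H => (α : Dual ℂ (lieSub H)) := by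
  obtain ⟨Q, hQ₁, hQ₂, hQ⟩ := exists_rootPairing_shortRoots H
  have : Finite (shortRoots H) := (finite_range (rootSys H).root).subset (shortRoots_subset H)
  have h : (Q.root : shortRoots H → _) = fun α : shortRoots H => (α : Dual ℂ (lieSub H)) := funext hQ
  rw [← h, ← Q.ker_linearCombination_root, h]
  rfl

lemma exists_exp_eq_of_shortRoots (a : shortRoots H → ℂˣ)
    (h₁ : ∀ α β : shortRoots H, (β : Dual ℂ (lieSub H)) = -α → a α * a β = 1)
    (h₂ : ∀ α β γ : shortRoots H, (α + β + γ : Dual ℂ (lieSub H)) = 0 → a α * a β * a γ = 1) :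
    ∃ X : lieSub H, ∀ α : shortRoots H, Complex.exp (α.1 X) = a α := by
  obtain ⟨Q, hQ₁, hQ₂, hQ⟩ := exists_rootPairing_shortRoots H
  have : Finite (shortRoots H) := (finite_range (rootSys H).root).subset (shortRoots_subset H)
  obtain ⟨f, hf⟩ := Q.exists_dual_exp_eq a (by simpa [hQ] using h₁) fun α β γ h => by
    have hγ : ((Q.reflectionPerm γ γ : shortRoots H) : Dual ℂ (lieSub H)) = -γ := by
      rw [← hQ, ← hQ]; simp
    -- The symmetric relation for `α + β + (-γ) = 0` becomes `a α * a β = a γ` after cancelling `a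
    -- (-γ)`.
    have h3 := h₂ α β (Q.reflectionPerm γ γ) (by rw [hγ, ← hQ, ← hQ, ← hQ, h, add_neg_cancel])
    have h4 := h₁ γ _ hγ
    rw [← mul_left_inj (a (Q.reflectionPerm γ γ)), h3, h4]
  refine ⟨(evalEquiv ℂ (lieSub H)).symm f, fun α => ?_⟩
  rw [← hf, hQ]
  simp

/-- A root that is not short exceeds a short root with which it has a positive pairing by a short
root. -/
lemma exists_shortRoot_sub_shortRoot (i : (lieSub H).root)
    (hi : (rootSys H).root i ∉ shortRoots H) :
    ∃ j, (rootSys H).root j ∈ shortRoots H ∧ 0 < (rootSys H).pairingIn ℤ i j ∧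
      (rootSys H).root i - (rootSys H).root j ∈ shortRoots H := by
  obtain ⟨l, hl⟩ := exists_shortRoot H
  have hlt : ((rootSys H).posRootForm ℤ).rootLength l < ((rootSys H).posRootForm ℤ).rootLength i := by
    rw [root_mem_shortRoots_iff H hl] at hi
    obtain ⟨l', hl', hle⟩ := hl
    obtain rfl := (rootSys H).root.injective hl'
    exact lt_of_le_of_ne (hle i) (Ne.symm hi)
  obtain ⟨j, k, hj, hk, hij, hijk⟩ := (rootSys H).exists_root_sub_root_of_rootLength_lt hlt
  exact ⟨j, (root_mem_shortRoots_iff H hl).mpr hj, hij,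
    hijk ▸ (root_mem_shortRoots_iff H hl).mpr hk⟩

end LinAlgGroup

end ShortRoots

/-! ### The closed subgroup theorem -/

section ClosedSubgroups

open Filter Topology NormedSpace

section ExpUnit

variable {A : Type*} [NormedRing A] [NormedAlgebra ℝ A] [CompleteSpace A]

lemma exp_mul_exp_of_commute {X Y : A} (h : Commute X Y) : exp (X + Y) = exp X * exp Y :=
  letI := NormedAlgebra.restrictScalars ℚ ℝ A
  exp_add_of_commute h

/-- The exponential as a unit of a real Banach algebra. -/
noncomputable def expUnit (X : A) : Aˣ where
  val := exp X
  inv := exp (-X)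
  val_inv := by rw [← exp_mul_exp_of_commute (Commute.refl X).neg_right, add_neg_cancel, exp_zero]
  inv_val := by rw [← exp_mul_exp_of_commute (Commute.refl X).neg_left, neg_add_cancel, exp_zero]

lemma expUnit_add_of_commute {X Y : A} (h : Commute X Y) :
    expUnit (X + Y) = expUnit X * expUnit Y :=
  Units.ext (exp_mul_exp_of_commute h)

lemma expUnit_zero : expUnit (0 : A) = 1 := Units.ext exp_zero

lemma expUnit_neg (X : A) : expUnit (-X) = (expUnit X)⁻¹ := Units.ext rfl

lemma expUnit_zsmul (k : ℤ) (X : A) : expUnit (k • X) = expUnit X ^ k := by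
  have hn : ∀ m : ℕ, expUnit (m • X) = expUnit X ^ m := fun m => by
    induction m with
    | zero => simp [expUnit_zero]
    | succ m ih =>
      rw [succ_nsmul, expUnit_add_of_commute ((Commute.refl X).smul_left m), ih, pow_succ]
  obtain ⟨m, rfl | rfl⟩ := k.eq_nat_or_neg
  · simpa using hn m
  · rw [neg_smul, expUnit_neg, zpow_neg, natCast_zsmul, hn, zpow_natCast]

lemma continuous_expUnit : Continuous (expUnit : A → Aˣ) :=
  letI := NormedAlgebra.restrictScalars ℚ ℝ A
  Units.continuous_iff.mpr ⟨exp_continuous, exp_continuous.comp continuous_neg⟩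

end ExpUnit

section ClosedSubgroup

variable {A : Type*} [NormedRing A] [NormedAlgebra ℝ A] [CompleteSpace A]

/-- Integer multiples of the small vectors `Y k` approximate `t • U`, and their exponentials are
powers of elements of `Γ`. Limit directions are thus tangent to `Γ`. -/
lemma expUnit_smul_mem_of_tendsto {Γ : Subgroup Aˣ} (hΓ : IsClosed (Γ : Set Aˣ))
    {Y : ℕ → A} {U : A} (hY : ∀ k, expUnit (Y k) ∈ Γ) (hY0 : ∀ k, Y k ≠ 0)
    (hlim : Tendsto Y atTop (𝓝 0)) (hU : Tendsto (fun k => ‖Y k‖⁻¹ • Y k) atTop (𝓝 U)) (t : ℝ) :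
    expUnit (t • U) ∈ Γ := by
  have hnorm : ∀ k, 0 < ‖Y k‖ := fun k => norm_pos_iff.mpr (hY0 k)
  -- Rounding down costs at most `‖Y k‖`, which tends to 0.
  have h1 : Tendsto (fun k => (⌊t / ‖Y k‖⌋ : ℝ) * ‖Y k‖) atTop (𝓝 t) := by
    have h0 : Tendsto (fun k => ‖Y k‖) atTop (𝓝 0) := by simpa using hlim.norm
    refine tendsto_of_tendsto_of_tendsto_of_le_of_le (g := fun k => t - ‖Y k‖) (h := fun _ => t)
      (by simpa using tendsto_const_nhds.sub h0) tendsto_const_nhds (fun k => ?_) fun k => ?_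
    · have := Int.lt_floor_add_one (t / ‖Y k‖)
      rw [div_lt_iff₀ (hnorm k)] at this
      show t - ‖Y k‖ ≤ _
      linarith
    · have := Int.floor_le (t / ‖Y k‖)
      rwa [le_div_iff₀ (hnorm k)] at this
  have h2 : Tendsto (fun k => ⌊t / ‖Y k‖⌋ • Y k) atTop (𝓝 (t • U)) := by
    refine (h1.smul hU).congr fun k => ?_
    rw [smul_smul, mul_assoc, mul_inv_cancel₀ (hnorm k).ne', mul_one, Int.cast_smul_eq_zsmul]
  refine hΓ.mem_of_tendsto ((continuous_expUnit.tendsto _).comp h2) (.of_forall fun k => ?_)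
  simp only [Function.comp, expUnit_zsmul]
  exact Γ.zpow_mem (hY k) _

/-- **Closed subgroup theorem**: near the identity, a closed subgroup of the group of units of a
finite dimensional algebra is the exponential image of its Lie algebra. -/
theorem eventually_exists_expUnit_eq [FiniteDimensional ℝ A] {Γ : Subgroup Aˣ}
    (hΓ : IsClosed (Γ : Set Aˣ)) (S : Submodule ℝ A)
    (hS : ∀ X, X ∈ S ↔ ∀ t : ℝ, expUnit (t • X) ∈ Γ) :
    ∀ᶠ g in 𝓝 (1 : Aˣ), g ∈ Γ → ∃ X ∈ S, g = expUnit X := by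
  have hSexp : ∀ X ∈ S, expUnit X ∈ Γ := fun X hX => by simpa using (hS X).mp hX 1
  obtain ⟨T, hT⟩ := S.exists_isCompl
  -- Otherwise, by compactness of the unit sphere, normalised counterexamples accumulate at a unit
  -- vector of `T` that also lies in `S`.
  have key : ∀ᶠ Y : T in 𝓝 0, expUnit (Y : A) ∈ Γ → Y = 0 := by
    by_contra hcon
    obtain ⟨Y, hlim, hY⟩ := exists_seq_forall_of_frequently (not_eventually.mp hcon)
    simp only [Classical.not_imp] at hY
    let u : ℕ → T := fun k => ‖Y k‖⁻¹ • Y k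
    have hu : ∀ k, u k ∈ Metric.sphere (0 : T) 1 := fun k => by
      rw [mem_sphere_zero_iff_norm, norm_smul, norm_inv, norm_norm,
        inv_mul_cancel₀ (norm_ne_zero_iff.mpr (hY k).2)]
    obtain ⟨U, hU, φ, hφ, hUlim⟩ := (isCompact_sphere (0 : T) 1).tendsto_subseq hu
    have hUS : (U : A) ∈ S := (hS U).mpr fun t =>
      expUnit_smul_mem_of_tendsto hΓ (Y := fun k => (Y (φ k) : A)) (fun k => (hY _).1)
        (fun k => by simpa using (hY (φ k)).2)
        ((continuous_subtype_val.tendsto (0 : T)).comp (hlim.comp hφ.tendsto_atTop))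
        ((continuous_subtype_val.tendsto U).comp hUlim) t
    have : (U : A) = 0 := Submodule.disjoint_def.mp hT.disjoint _ hUS U.2
    have hU0 : U = 0 := by simpa using this
    simp [hU0] at hU
  let e : (S × T) ≃L[ℝ] A := (Submodule.prodEquivOfIsCompl S T hT).toContinuousLinearEquiv
  let Φ : S × T → A := fun p => exp (p.1 : A) * exp (p.2 : A)
  have hΦ : HasStrictFDerivAt Φ (e : (S × T) →L[ℝ] A) 0 := by
    have h0 : HasStrictFDerivAt (exp : A → A) (1 : A →L[ℝ] A) 0 := hasStrictFDerivAt_exp_zero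
    have h1 : HasStrictFDerivAt (fun p : S × T => exp (p.1 : A))
        (S.subtypeL ∘L .fst ℝ S T) 0 := by
      have := HasStrictFDerivAt.comp (g := exp) (x := (0 : S × T)) (g' := (1 : A →L[ℝ] A))
        (f := fun p : S × T => (p.1 : A)) (by simpa using h0)
        (S.subtypeL ∘L .fst ℝ S T).hasStrictFDerivAt
      exact this
    have h2 : HasStrictFDerivAt (fun p : S × T => exp (p.2 : A))
        (T.subtypeL ∘L .snd ℝ S T) 0 := by
      have := HasStrictFDerivAt.comp (g := exp) (x := (0 : S × T)) (g' := (1 : A →L[ℝ] A))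
        (f := fun p : S × T => (p.2 : A)) (by simpa using h0)
        (T.subtypeL ∘L .snd ℝ S T).hasStrictFDerivAt
      exact this
    refine (h1.mul' h2).congr_fderiv ?_
    ext p <;> simp [e, exp_zero]
  have hΦ1 : Φ 0 = 1 := by simp [Φ, exp_zero]
  -- Inverse function theorem: every element near 1 is `exp X * exp Y` with small `X ∈ S` and `Y ∈
  -- T`.
  have hmap : map Φ (𝓝 0) = 𝓝 1 := by rw [hΦ.map_nhds_eq_of_equiv, hΦ1]
  have hev : ∀ᶠ a in 𝓝 (1 : A), ∀ g : Aˣ, (g : A) = a → g ∈ Γ → ∃ X ∈ S, g = expUnit X := by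
    rw [← hmap, eventually_map]
    have : ∀ᶠ p : S × T in 𝓝 0, expUnit (p.2 : A) ∈ Γ → p.2 = 0 :=
      (continuous_snd.tendsto (0 : S × T)).eventually key
    filter_upwards [this] with p hp g hg hgΓ
    have hg' : g = expUnit (p.1 : A) * expUnit (p.2 : A) := Units.ext hg
    have h2 := hp ((Γ.mul_mem_cancel_left (hSexp _ p.1.2)).mp (hg' ▸ hgΓ))
    exact ⟨p.1, p.1.2, by rw [hg', h2]; simp [expUnit_zero]⟩
  exact (Units.continuous_val.tendsto' (1 : Aˣ) 1 rfl).eventually hev |>.mono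
    fun g hg => hg g rfl

/-- A closed connected subgroup of the group of units of a finite dimensional algebra is generated
by the exponentials of the elements of its Lie algebra. -/
theorem le_of_isConnected_of_expUnit_mem [FiniteDimensional ℝ A] {Γ : Subgroup Aˣ}
    (hΓ : IsClosed (Γ : Set Aˣ)) (hconn : IsConnected (Γ : Set Aˣ)) (S : Submodule ℝ A)
    (hS : ∀ X, X ∈ S ↔ ∀ t : ℝ, expUnit (t • X) ∈ Γ) {Δ : Subgroup Aˣ}
    (hΔ : ∀ X ∈ S, expUnit X ∈ Δ) : Γ ≤ Δ := by
  have : ConnectedSpace Γ := isConnected_iff_connectedSpace.mp hconn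
  have hopen : IsOpen ((Δ.subgroupOf Γ : Subgroup Γ) : Set Γ) := by
    refine Subgroup.isOpen_of_mem_nhds (g := 1) _ ?_
    have h := (continuous_subtype_val.tendsto' (1 : Γ) (1 : Aˣ) rfl).eventually
      (eventually_exists_expUnit_eq hΓ S hS)
    filter_upwards [h] with g hg
    obtain ⟨X, hX, hgX⟩ := hg g.2
    exact Subgroup.mem_subgroupOf.mpr (hgX ▸ hΔ X hX)
  have htop : ((Δ.subgroupOf Γ : Subgroup Γ) : Set Γ) = Set.univ :=
    IsClopen.eq_univ ⟨Subgroup.isClosed_of_isOpen _ hopen, hopen⟩ ⟨1, one_mem _⟩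
  exact Subgroup.subgroupOf_eq_top.mp (SetLike.coe_injective (by simpa using htop))

end ClosedSubgroup

end ClosedSubgroups

/-! ### Exponentials in Zariski closed linear groups -/

section LinearGroups

open Filter Topology NormedSpace MvPolynomial

attribute [local instance] Matrix.linftyOpNormedRing
attribute [local instance] Matrix.linftyOpNormedAlgebra

namespace LinAlgGroup

attribute [local instance 100] LieRing.ofAssociativeRing

variable {n : ℕ}

/-- The matrix exponential, as an element of the general linear group. -/
noncomputable def expGL (X : Matrix (Fin n) (Fin n) ℂ) : GL (Fin n) ℂ := expUnit X

lemma coe_expGL (X : Matrix (Fin n) (Fin n) ℂ) : (expGL X).1 = exp X := rfl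

lemma expGL_zero : expGL (0 : Matrix (Fin n) (Fin n) ℂ) = 1 := expUnit_zero

lemma expGL_neg (X : Matrix (Fin n) (Fin n) ℂ) : expGL (-X) = (expGL X)⁻¹ := expUnit_neg X

lemma expGL_add_of_commute {X Y : Matrix (Fin n) (Fin n) ℂ} (h : Commute X Y) :
    expGL (X + Y) = expGL X * expGL Y := expUnit_add_of_commute h

lemma hasDerivAt_exp_smul_entry (X : Matrix (Fin n) (Fin n) ℂ) (i j : Fin n) (t : ℂ) :
    HasDerivAt (fun t : ℂ => exp (t • X) i j) ((exp (t • X) * X) i j) t :=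
  (hasDerivAt_pi.mp ((hasDerivAt_pi.mp (hasDerivAt_exp_smul_const X t)) i)) j

lemma hasDerivAt_eval_exp_smul (X : Matrix (Fin n) (Fin n) ℂ)
    (p : MvPolynomial (Fin n × Fin n) ℂ) (t : ℂ) :
    HasDerivAt (fun t : ℂ => eval (fun ij => exp (t • X) ij.1 ij.2) p)
      (eval (fun ij => exp (t • X) ij.1 ij.2) (leftInvDerivation X p)) t := by
  induction p using MvPolynomial.induction_on with
  | C a => simpa [leftInvDerivation] using hasDerivAt_const t a
  | add p q hp hq =>
    simp only [map_add]
    exact hp.add hq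
  | mul_X p ij hp =>
    have h := hp.mul (hasDerivAt_exp_smul_entry X ij.1 ij.2 t)
    simp only [map_mul, eval_X]
    refine h.congr_deriv ?_
    simp [Derivation.leibniz, leftInvDerivation, mkDerivation_X, Matrix.mul_apply, mul_comm]
    ring

/-- If the derivatives `f k` of an entire function `f 0` all vanish at the origin, then it
vanishes. -/
lemma _root_.eq_zero_of_forall_hasDerivAt_succ {f : ℕ → ℂ → ℂ}
    (hf : ∀ k t, HasDerivAt (f k) (f (k + 1) t) t) (h0 : ∀ k, f k 0 = 0) (t : ℂ) : f 0 t = 0 := by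
  have hiter : ∀ k, iteratedDeriv k (f 0) = f k := by
    intro k
    induction k with
    | zero => simp
    | succ k ih => rw [iteratedDeriv_succ, ih]; exact funext fun s => (hf k s).deriv
  rw [← Complex.taylorSeries_eq_of_entire (fun s => (hf 0 s).differentiableAt) 0 t]
  refine (tsum_congr fun k => ?_).trans tsum_zero
  rw [hiter, h0]
  simp

/-- The left invariant derivation of `X` preserves the vanishing ideal, so all derivatives at 0 of
the entire function `t ↦ p (exp (t X))` vanish. -/
lemma eval_exp_smul_eq_zero {Γ : Subgroup (GL (Fin n) ℂ)} {X : Matrix (Fin n) (Fin n) ℂ}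
    (hX : X ∈ lieAlg Γ) {p : MvPolynomial (Fin n × Fin n) ℂ} (hp : p ∈ vanishingIdeal Γ) (t : ℂ) :
    eval (fun ij => exp (t • X) ij.1 ij.2) p = 0 := by
  have hmem : ∀ k, (leftInvDerivation X)^[k] p ∈ vanishingIdeal Γ := by
    intro k
    induction k with
    | zero => exact hp
    | succ k ih => rw [Function.iterate_succ_apply']; exact leftInvDerivation_mem hX ih
  let f : ℕ → ℂ → ℂ := fun k t =>
    eval (fun ij => exp (t • X) ij.1 ij.2) ((leftInvDerivation X)^[k] p)
  have hf : ∀ k s, HasDerivAt (f k) (f (k + 1) s) s := fun k s => by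
    have := hasDerivAt_eval_exp_smul X ((leftInvDerivation X)^[k] p) s
    rwa [← Function.iterate_succ_apply' (leftInvDerivation X)] at this
  have h0 : ∀ k, f k 0 = 0 := fun k => by
    simp only [f, zero_smul, exp_zero]
    exact hmem k 1 Γ.one_mem
  exact eq_zero_of_forall_hasDerivAt_succ hf h0 t

lemma isClosed_of_isZariskiClosed {Γ : Subgroup (GL (Fin n) ℂ)} (hΓ : IsZariskiClosed Γ) :
    IsClosed (Γ : Set (GL (Fin n) ℂ)) := by
  obtain ⟨S, hS⟩ := hΓ
  have : (Γ : Set (GL (Fin n) ℂ)) = ⋂ p ∈ S, {g | eval (fun ij => g.1 ij.1 ij.2) p = 0} := by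
    ext g; simp [hS]
  rw [this]
  refine isClosed_biInter fun p _ => isClosed_eq ?_ continuous_const
  exact (MvPolynomial.continuous_eval p).comp
    (continuous_pi fun ij => Units.continuous_val.matrix_elem ij.1 ij.2)

lemma expGL_mem {Γ : Subgroup (GL (Fin n) ℂ)} (hΓ : IsZariskiClosed Γ)
    {X : Matrix (Fin n) (Fin n) ℂ} (hX : X ∈ lieAlg Γ) : expGL X ∈ Γ := by
  obtain ⟨S, hS⟩ := hΓ
  refine (hS _).mpr fun p hp => ?_
  have := eval_exp_smul_eq_zero hX (p := p) (fun g hg => (hS g).mp hg p hp) 1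
  rw [coe_expGL]
  simpa only [one_smul] using this

/-- The algebraic tangent space agrees with the analytic Lie algebra. Real parameters suffice, and
they are the ones in the closed subgroup theorem. -/
lemma mem_lieAlg_iff {Γ : Subgroup (GL (Fin n) ℂ)} (hΓ : IsZariskiClosed Γ)
    (X : Matrix (Fin n) (Fin n) ℂ) :
    X ∈ lieAlg Γ ↔ ∀ t : ℝ, expGL (t • X) ∈ Γ := by
  refine ⟨fun hX t => expGL_mem hΓ ?_, fun hX p hp => ?_⟩
  · rw [← Complex.coe_smul]
    exact (lieAlg Γ).smul_mem _ hX
  · have h1 := (hasDerivAt_eval_exp_smul X p ((0 : ℝ) : ℂ)).comp_ofReal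
    have h2 : (fun t : ℝ => eval (fun ij => exp ((t : ℂ) • X) ij.1 ij.2) p) = fun _ => 0 :=
      funext fun t => by
        rw [Complex.coe_smul]
        have := hp _ (hX t)
        rwa [coe_expGL] at this
    rw [h2] at h1
    have h3 := h1.unique (hasDerivAt_const _ _)
    rw [derivAtOne_eq]
    simpa using h3

lemma le_of_expGL_mem {Γ Δ : Subgroup (GL (Fin n) ℂ)} (hΓ : IsZariskiClosed Γ)
    (hconn : IsConnected (Γ : Set (GL (Fin n) ℂ))) (hΔ : ∀ X ∈ lieAlg Γ, expGL X ∈ Δ) :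
    Γ ≤ Δ :=
  le_of_isConnected_of_expUnit_mem (isClosed_of_isZariskiClosed hΓ) hconn
    ((lieAlg Γ).toSubmodule.restrictScalars ℝ) (mem_lieAlg_iff hΓ) hΔ

/-- For a commutative Lie algebra the image of `exp` is itself a subgroup, so it is all of the
connected group. -/
lemma exists_expGL_eq_of_commute {Γ : Subgroup (GL (Fin n) ℂ)} (hΓ : IsZariskiClosed Γ)
    (hconn : IsConnected (Γ : Set (GL (Fin n) ℂ)))
    (hcomm : ∀ X ∈ lieAlg Γ, ∀ Y ∈ lieAlg Γ, Commute X Y) {g : GL (Fin n) ℂ} (hg : g ∈ Γ) :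
    ∃ X ∈ lieAlg Γ, g = expGL X := by
  let Δ : Subgroup (GL (Fin n) ℂ) :=
    { carrier := {g | ∃ X ∈ lieAlg Γ, g = expGL X}
      one_mem' := ⟨0, (lieAlg Γ).zero_mem, expGL_zero.symm⟩
      mul_mem' := by
        rintro _ _ ⟨X, hX, rfl⟩ ⟨Y, hY, rfl⟩
        exact ⟨X + Y, (lieAlg Γ).add_mem hX hY, (expGL_add_of_commute (hcomm X hX Y hY)).symm⟩
      inv_mem' := by
        rintro _ ⟨X, hX, rfl⟩
        exact ⟨-X, (lieAlg Γ).neg_mem hX, (expGL_neg X).symm⟩ }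
  exact le_of_expGL_mem (Δ := Δ) hΓ hconn (fun X hX => ⟨X, hX, rfl⟩) hg

end LinAlgGroup

end LinearGroups

/-! ### The differential of a regular representation -/

section Differential

open Filter Topology NormedSpace MvPolynomial Module

attribute [local instance] Matrix.linftyOpNormedRing
attribute [local instance] Matrix.linftyOpNormedAlgebra

namespace LinAlgGroup

attribute [local instance 100] LieRing.ofAssociativeRing

variable {n : ℕ} {G : Subgroup (GL (Fin n) ℂ)}

lemma coe_conj_mem_lieAlg (hG : IsZariskiClosed G) {g : GL (Fin n) ℂ} (hg : g ∈ G)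
    {X : Matrix (Fin n) (Fin n) ℂ} (hX : X ∈ lieAlg G) : g.1 * X * (g⁻¹).1 ∈ lieAlg G := by
  rw [mem_lieAlg_iff hG] at hX ⊢
  intro t
  have h : expGL (t • (g.1 * X * (g⁻¹).1)) = g * expGL (t • X) * g⁻¹ := by
    let := NormedAlgebra.restrictScalars ℚ ℝ (Matrix (Fin n) (Fin n) ℂ)
    refine Units.ext ?_
    have := exp_units_conj g (t • X)
    rw [mul_smul_comm, smul_mul_assoc] at this
    exact this
  rw [h]
  exact G.mul_mem (G.mul_mem hg (hX t)) (G.inv_mem hg)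

/-- The exponential map from the Lie algebra of `G` to `G`. -/
noncomputable def expG (hG : IsZariskiClosed G) (X : lieAlg G) : G := ⟨expGL X, expGL_mem hG X.2⟩

lemma expG_zero (hG : IsZariskiClosed G) : expG hG 0 = 1 := Subtype.ext expGL_zero

lemma expG_add_smul (hG : IsZariskiClosed G) (s t : ℂ) (X : lieAlg G) :
    expG hG ((s + t) • X) = expG hG (s • X) * expG hG (t • X) := by
  refine Subtype.ext ?_
  have : (((s + t) • X : lieAlg G) : Matrix (Fin n) (Fin n) ℂ) = s • X.1 + t • X.1 := add_smul _ _ _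
  show expGL _ = _
  rw [this]
  exact expGL_add_of_commute (((Commute.refl X.1).smul_left s).smul_right t)

lemma expG_neg (hG : IsZariskiClosed G) (X : lieAlg G) : expG hG (-X) = (expG hG X)⁻¹ :=
  Subtype.ext (expGL_neg _)

lemma expG_conj (hG : IsZariskiClosed G) (g : G) (X : lieAlg G) :
    expG hG ⟨_, coe_conj_mem_lieAlg hG g.2 X.2⟩ = g * expG hG X * g⁻¹ := by
  let := NormedAlgebra.restrictScalars ℚ ℝ (Matrix (Fin n) (Fin n) ℂ)
  exact Subtype.ext (Units.ext (exp_units_conj g.1 X.1))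

variable {V : Type*} [AddCommGroup V] [Module ℂ V] {ρ : Representation ℂ G V}

/-- The value at `X` of the derivative at the identity of `p`, as a linear function of `X`. -/
noncomputable def derivAtOneLin (p : MvPolynomial (Fin n × Fin n) ℂ) :
    Matrix (Fin n) (Fin n) ℂ →ₗ[ℂ] ℂ where
  toFun X := derivAtOne X p
  map_add' X Y := by simp [derivAtOne, add_mul, Finset.sum_add_distrib]
  map_smul' c X := by simp [derivAtOne, mul_assoc, Finset.mul_sum]

lemma exists_hasDerivAt_coeff (hG : IsZariskiClosed G) (hreg : IsRegularRep ρ) (v : V)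
    (φ : Dual ℂ V) : ∃ L : Matrix (Fin n) (Fin n) ℂ →ₗ[ℂ] ℂ, ∀ X : lieAlg G,
      HasDerivAt (fun t : ℂ => φ (ρ (expG hG (t • X)) v)) (L X) 0 := by
  obtain ⟨p, k, hpk⟩ := hreg v φ
  let q : MvPolynomial (Fin n × Fin n) ℂ := (Matrix.mvPolynomialX (Fin n) (Fin n) ℂ).det ^ k
  have hq : ∀ M : Matrix (Fin n) (Fin n) ℂ, eval (fun ij => M ij.1 ij.2) q = M.det ^ k := fun M => by
    simp only [q, map_pow, Matrix.eval_det_mvPolynomialX]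
    rfl
  -- The quotient rule for `p / det ^ k` at the identity, where the denominator is 1.
  refine ⟨derivAtOneLin p -
    (eval (fun ij => (1 : Matrix (Fin n) (Fin n) ℂ) ij.1 ij.2) p) • derivAtOneLin q, fun X => ?_⟩
  have hp' := hasDerivAt_eval_exp_smul X.1 p 0
  have hq' := hasDerivAt_eval_exp_smul X.1 q 0
  have hq1 : eval (fun ij => exp ((0 : ℂ) • X.1) ij.1 ij.2) q = 1 := by
    rw [hq]; simp [exp_zero]
  have h := hp'.div hq' (by rw [hq1]; exact one_ne_zero)
  refine (h.congr_deriv ?_).congr_of_eventuallyEq (.of_forall fun t => ?_)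
  · rw [hq1]
    simp only [zero_smul, exp_zero, ← derivAtOne_eq]
    simp only [div_one, mul_one, one_pow, LinearMap.sub_apply, LinearMap.smul_apply, smul_eq_mul]
    rfl
  · refine (hpk _).trans ?_
    simp only [Pi.div_apply, hq]
    rfl

lemma _root_.Module.Basis.sum_coord_mul {ι K V : Type*} [Fintype ι] [Field K] [AddCommGroup V]
    [Module K V] (b : Basis ι K V) (ψ : Dual K V) (w : V) : ∑ i, b.coord i w * ψ (b i) = ψ w := by
  conv_rhs => rw [← b.sum_repr w]
  simp only [map_sum, map_smul, smul_eq_mul, Basis.coord_apply]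

lemma _root_.Module.eq_of_forall_dual_apply_eq (K : Type*) {V : Type*} [Field K] [AddCommGroup V]
    [Module K V] {v w : V} (h : ∀ φ : Dual K V, φ v = φ w) : v = w :=
  sub_eq_zero.mp <| (forall_dual_apply_eq_zero_iff K _).mp fun φ => by rw [map_sub, h, sub_self]

variable [FiniteDimensional ℂ V]

/-- The operator is assembled from derivatives of matrix coefficients in a basis. Linearity in `X`
comes from the coefficients, linearity in `v` from uniqueness of derivatives. -/
lemma exists_differential (hG : IsZariskiClosed G) (hreg : IsRegularRep ρ) :
    ∃ D : lieAlg G →ₗ[ℂ] End ℂ V, ∀ (X : lieAlg G) (v : V) (φ : Dual ℂ V),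
      HasDerivAt (fun t : ℂ => φ (ρ (expG hG (t • X)) v)) (φ (D X v)) 0 := by
  choose L hL using exists_hasDerivAt_coeff hG hreg
  let b := finBasis ℂ V
  let d : lieAlg G → V → V := fun X v => ∑ i, L v (b.coord i) X • b i
  have hd : ∀ (X : lieAlg G) (v : V) (φ : Dual ℂ V),
      HasDerivAt (fun t : ℂ => φ (ρ (expG hG (t • X)) v)) (φ (d X v)) 0 := fun X v φ => by
    have h := HasDerivAt.fun_sum (u := Finset.univ) fun i _ =>
      (hL v (b.coord i) X).mul_const (φ (b i))
    refine (h.congr_deriv ?_).congr_of_eventuallyEq (.of_forall fun t => ?_)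
    · simp [d]
    · exact (b.sum_coord_mul φ _).symm
  have huniq : ∀ (X : lieAlg G) (v w : V), (∀ φ : Dual ℂ V,
      HasDerivAt (fun t : ℂ => φ (ρ (expG hG (t • X)) v)) (φ w) 0) → d X v = w := fun X v w h =>
    eq_of_forall_dual_apply_eq ℂ fun φ => (hd X v φ).unique (h φ)
  refine ⟨{ toFun := fun X => { toFun := d X, map_add' := fun v w => ?_, map_smul' := fun c v => ?_ }
            map_add' := fun X Y => ?_
            map_smul' := fun c X => ?_ }, hd⟩
  · refine huniq X _ _ fun φ => ?_
    simp only [map_add]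
    exact (hd X v φ).add (hd X w φ)
  · refine huniq X _ _ fun φ => ?_
    simp only [map_smul, RingHom.id_apply]
    exact (hd X v φ).const_smul c
  · ext v
    simp [d, add_smul, Finset.sum_add_distrib]
  · ext v
    simp [d, mul_smul, Finset.smul_sum]

/-- The differential of a regular representation. -/
noncomputable def differential (hG : IsZariskiClosed G) (hreg : IsRegularRep ρ) :
    lieAlg G →ₗ[ℂ] End ℂ V := (exists_differential hG hreg).choose

variable (hG : IsZariskiClosed G) (hreg : IsRegularRep ρ)

lemma hasDerivAt_coeff_zero (X : lieAlg G) (v : V) (φ : Dual ℂ V) :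
    HasDerivAt (fun t : ℂ => φ (ρ (expG hG (t • X)) v)) (φ (differential hG hreg X v)) 0 :=
  (exists_differential hG hreg).choose_spec X v φ

lemma hasDerivAt_coeff (X : lieAlg G) (v : V) (φ : Dual ℂ V) (t : ℂ) :
    HasDerivAt (fun t : ℂ => φ (ρ (expG hG (t • X)) v))
      (φ (ρ (expG hG (t • X)) (differential hG hreg X v))) t := by
  have h := hasDerivAt_coeff_zero hG hreg X v (φ ∘ₗ ρ (expG hG (t • X)))
  have h' := HasDerivAt.comp_sub_const t t (by simpa using h)
  refine h'.congr_of_eventuallyEq (.of_forall fun s => ?_)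
  have : s = t + (s - t) := by ring
  show φ _ = _
  conv_lhs => rw [this, expG_add_smul, map_mul]
  rfl

lemma differential_eq_of_hasDerivAt {X : lieAlg G} {v w : V} (h : ∀ φ : Dual ℂ V,
    HasDerivAt (fun t : ℂ => φ (ρ (expG hG (t • X)) v)) (φ w) 0) :
    differential hG hreg X v = w :=
  eq_of_forall_dual_apply_eq ℂ fun φ => (hasDerivAt_coeff_zero hG hreg X v φ).unique (h φ)

lemma differential_conj (g : G) (X : lieAlg G) (v : V) :
    differential hG hreg ⟨_, coe_conj_mem_lieAlg hG g.2 X.2⟩ v =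
      ρ g (differential hG hreg X (ρ g⁻¹ v)) := by
  refine differential_eq_of_hasDerivAt hG hreg fun φ => ?_
  have h := hasDerivAt_coeff_zero hG hreg X (ρ g⁻¹ v) (φ ∘ₗ ρ g)
  refine h.congr_of_eventuallyEq (.of_forall fun t => ?_)
  have : t • (⟨_, coe_conj_mem_lieAlg hG g.2 X.2⟩ : lieAlg G) =
      ⟨_, coe_conj_mem_lieAlg hG g.2 (t • X).2⟩ := Subtype.ext (by
    show t • (_ * X.1 * _) = _ * (t • X.1) * _
    simp)
  simp only [this, expG_conj, map_mul]
  rfl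

/-- Conjugating `X` by `exp (s Y)` gives a curve with derivative `⁅Y, X⁆` at 0. Its image under the
differential is `D X` conjugated by `ρ (exp (s Y))`, with derivative `⁅D Y, D X⁆`. -/
lemma differential_lie (Y X : lieAlg G) :
    differential hG hreg ⁅Y, X⁆ = ⁅differential hG hreg Y, differential hG hreg X⁆ := by
  ext v
  refine eq_of_forall_dual_apply_eq ℂ fun φ => ?_
  set D := differential hG hreg with hD
  let b := finBasis ℂ V
  let adj : ℂ → Matrix (Fin n) (Fin n) ℂ := fun s => exp (s • Y.1) * X.1 * exp (s • (-Y).1)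
  -- Extended to all matrices, the functional can be applied to the curve `adj` in matrix space.
  obtain ⟨ℓ, hℓ⟩ := LinearMap.exists_extend (p := (lieAlg G).toSubmodule)
    (φ ∘ₗ LinearMap.applyₗ v ∘ₗ D)
  have hℓ' : ∀ Z : lieAlg G, ℓ Z.1 = φ (D Z v) := fun Z => LinearMap.congr_fun hℓ Z
  have hadj : ∀ s : ℂ, adj s = (expG hG (s • Y)).1.1 * X.1 * ((expG hG (s • Y))⁻¹).1.1 := fun s => by
    rw [← expG_neg, ← smul_neg]
    rfl
  have hleft : HasDerivAt (fun s => ℓ (adj s)) (φ (D ⁅Y, X⁆ v)) 0 := by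
    have h1 := hasDerivAt_exp_smul_const' (𝕂 := ℂ) Y.1 0
    have h2 := hasDerivAt_exp_smul_const' (𝕂 := ℂ) (-Y).1 0
    have h3 := (h1.mul_const X.1).mul h2
    have h4 := (LinearMap.toContinuousLinearMap ℓ).hasFDerivAt.comp_hasDerivAt 0 h3
    refine h4.congr_deriv ?_
    rw [← hℓ']
    have h0 : ∀ Z : Matrix (Fin n) (Fin n) ℂ, exp ((0 : ℂ) • Z) = 1 := fun Z => by
      rw [zero_smul, exp_zero]
    show ℓ (Y.1 * exp ((0 : ℂ) • Y.1) * X.1 * exp ((0 : ℂ) • (-Y).1) +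
      exp ((0 : ℂ) • Y.1) * X.1 * ((-Y).1 * exp ((0 : ℂ) • (-Y).1))) = _
    rw [h0, h0]
    congr 1
    simp [LieRing.of_associative_ring_bracket, sub_eq_add_neg]
  have hright : HasDerivAt (fun s => ℓ (adj s)) (φ (⁅D Y, D X⁆ v)) 0 := by
    -- Expansion in a basis writes the product of operators as a sum of products of scalar
    -- functions.
    have h := HasDerivAt.fun_sum (u := Finset.univ) fun i _ =>
      (hasDerivAt_coeff_zero hG hreg (-Y) v (b.coord i ∘ₗ D X)).mul
        (hasDerivAt_coeff_zero hG hreg Y (b i) φ)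
    refine (h.congr_deriv ?_).congr_of_eventuallyEq (.of_forall fun s => ?_)
    · simp only [zero_smul, expG_zero, map_one, ← hD]
      have h2 := b.sum_coord_mul φ (D X (D (-Y) v))
      have h3 := b.sum_coord_mul (φ ∘ₗ D Y) (D X v)
      simp only [LinearMap.comp_apply] at h3
      simp only [Finset.sum_add_distrib, LinearMap.comp_apply, End.one_apply]
      rw [h2, h3]
      simp [LieRing.of_associative_ring_bracket]
      ring
    · show ℓ (adj s) = _
      rw [hadj]
      refine (hℓ' ⟨_, coe_conj_mem_lieAlg hG (expG hG (s • Y)).2 X.2⟩).trans ?_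
      rw [hD, differential_conj, ← expG_neg, ← smul_neg]
      exact (b.sum_coord_mul (φ ∘ₗ ρ (expG hG (s • Y))) _).symm
  exact hleft.unique hright

end LinAlgGroup

end Differential

/-! ### Weights of irreducible Lie modules -/

section LieModules

open Module LieAlgebra LieAlgebra.IsKilling

section LieModuleWeights

variable {K L V : Type*} [Field K] [LieRing L] [LieAlgebra K L]
  [FiniteDimensional K L] (H : LieSubalgebra K L) [H.IsCartanSubalgebra]
  [LieModule.IsTriangularizable K H L]
  [AddCommGroup V] [Module K V] [LieRingModule L V]

lemma lie_mem_of_forall_rootSpace {U U' : Submodule K V}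
    (h : ∀ (α : H → K), ∀ e ∈ rootSpace H α, ∀ v ∈ U, ⁅e, v⁆ ∈ U') (x : L) {v : V} (hv : v ∈ U) :
    ⁅x, v⁆ ∈ U' := by
  have hx : x ∈ ⨆ α : H → K, (rootSpace H α).toSubmodule := by
    rw [← LieSubmodule.iSup_toSubmodule, LieModule.iSup_genWeightSpace_eq_top]
    trivial
  refine Submodule.iSup_induction _ (motive := fun x => ⁅x, v⁆ ∈ U') hx
    (fun α e he => h α e he v hv) (by simp) fun x y hx hy => ?_
  rw [add_lie]
  exact U'.add_mem hx hy

variable [CharZero K] [IsKilling K L] [LieModule K L V]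

lemma lie_mem_weightSpace_add {α : H → K} {e : L} (he : e ∈ rootSpace H α) {μ : H → K} {v : V}
    (hv : v ∈ LieModule.weightSpace V μ) : ⁅e, v⁆ ∈ LieModule.weightSpace V (α + μ) := by
  rw [LieModule.mem_weightSpace] at hv ⊢
  intro h
  have h1 : ⁅(h : L), e⁆ = α h • e := lie_eq_smul_of_mem_rootSpace he h
  have h2 : ⁅(h : L), v⁆ = μ h • v := hv h
  show ⁅(h : L), ⁅e, v⁆⁆ = _
  rw [leibniz_lie, h1, h2, smul_lie, lie_smul, ← add_smul]
  rfl

/-- Root vectors permute the weight spaces up to inclusion, so their sum is a submodule. It is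
nonzero since the Cartan subalgebra has a common eigenvector. -/
lemma iSup_weightSpace_eq_top [IsAlgClosed K] [FiniteDimensional K V] [Nontrivial V]
    (hirr : ∀ U : Submodule K V, (∀ (x : L), ∀ v ∈ U, ⁅x, v⁆ ∈ U) → U = ⊥ ∨ U = ⊤) :
    ⨆ μ : Dual K H, (LieModule.weightSpace V μ).toSubmodule = ⊤ := by
  set U := ⨆ μ : Dual K H, (LieModule.weightSpace V μ).toSubmodule with hU
  -- A function on `H` with a nonzero weight space is automatically linear.
  have hU' : U = ⨆ μ : H → K, (LieModule.weightSpace V μ).toSubmodule := by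
    refine le_antisymm (iSup_le fun μ => le_iSup
      (fun μ : H → K => (LieModule.weightSpace V μ).toSubmodule) μ) (iSup_le fun μ => ?_)
    by_cases hμ : LieModule.weightSpace V μ = ⊥
    · simp [hμ]
    · have hg : LieModule.genWeightSpace V μ ≠ ⊥ := fun h =>
        hμ (le_bot_iff.mp (h ▸ LieModule.weightSpace_le_genWeightSpace V μ))
      exact le_iSup (fun μ : Dual K H => (LieModule.weightSpace V μ).toSubmodule)
        (LieModule.Weight.toLinear K H V ⟨μ, hg⟩)
  refine (hirr U fun x v hv => ?_).resolve_left ?_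
  · refine lie_mem_of_forall_rootSpace H (fun α e he w hw => ?_) x hv
    rw [hU'] at hw ⊢
    refine Submodule.iSup_induction _ (motive := fun w => ⁅e, w⁆ ∈ _) hw (fun μ w hw => ?_)
      (by simp) fun w w' hw hw' => ?_
    · exact Submodule.mem_iSup_of_mem (α + μ) (lie_mem_weightSpace_add H he hw)
    · rw [lie_add]
      exact Submodule.add_mem _ hw hw'
  · obtain ⟨χ, hχ⟩ := LieModule.exists_nontrivial_weightSpace_of_isNilpotent K H V
    intro h
    have h1 : (LieModule.weightSpace V χ).toSubmodule ≤ U :=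
      le_iSup (fun μ : Dual K H => (LieModule.weightSpace V μ).toSubmodule) χ
    rw [h, le_bot_iff] at h1
    rw [LieSubmodule.nontrivial_iff_ne_bot] at hχ
    exact hχ (by simpa using h1)

/-- If an irreducible module has both the weight zero and a nonzero weight, then it has a root as
a weight. -/
lemma exists_root_weightSpace_ne_bot
    (hirr : ∀ U : Submodule K V, (∀ (x : L), ∀ v ∈ U, ⁅x, v⁆ ∈ U) → U = ⊥ ∨ U = ⊤)
    (h0 : LieModule.weightSpace V (0 : H → K) ≠ ⊥)
    (h1 : LieModule.weightSpace V (0 : H → K) ≠ ⊤) :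
    ∃ α : H.root, LieModule.weightSpace V (α : H → K) ≠ ⊥ := by
  by_contra! hcon
  -- If no root is a weight, root vectors kill the zero weight space, which is then a proper nonzero
  -- submodule.
  have key : ∀ (α : H → K), ∀ e ∈ rootSpace H α, ∀ w ∈ LieModule.weightSpace V (0 : H → K),
      ⁅e, w⁆ ∈ LieModule.weightSpace V (0 : H → K) := fun α e he w hw => by
    have h2 := lie_mem_weightSpace_add H he hw
    rw [add_zero] at h2
    by_cases hα0 : α = 0
    · rwa [hα0] at h2
    by_cases hα : rootSpace H α = ⊥
    · rw [hα, LieSubmodule.mem_bot] at he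
      simp [he]
    · let α' : LieModule.Weight K H L := ⟨α, hα⟩
      have h3 := hcon ⟨α', by rw [Finset.mem_filter_univ]; exact hα0⟩
      have h4 : LieModule.weightSpace V α = ⊥ := h3
      rw [h4, LieSubmodule.mem_bot] at h2
      rw [h2]
      exact zero_mem _
  rcases hirr (LieModule.weightSpace V (0 : H → K)).toSubmodule fun x v hv =>
      lie_mem_of_forall_rootSpace H key x hv with h | h
  · exact h0 (by simpa using h)
  · exact h1 (by simpa using h)

/-- If a weight has a positive pairing with a root, then their difference is a weight. -/
lemma weightSpace_sub_root_ne_bot [FiniteDimensional K V] {μ : H → K} (β : H.root)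
    {c : ℕ} (hc : μ (coroot β.1) = c) (hc0 : 0 < c)
    (hμ : LieModule.weightSpace V μ ≠ ⊥) : LieModule.weightSpace V (-β + μ : H → K) ≠ ⊥ := by
  have hβ : β.1.IsNonZero := H.isNonZero_coe_root β
  obtain ⟨h, e, f, ht, he, hf⟩ := exists_isSl2Triple_of_weight_isNonZero hβ
  obtain ⟨v, hv, hv0⟩ : ∃ v ∈ LieModule.weightSpace V μ, v ≠ 0 := by
    simpa [LieSubmodule.eq_bot_iff] using hμ
  intro hbot
  have h1 := lie_mem_weightSpace_add H hf hv
  have h2 : ⁅f, v⁆ = 0 := by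
    rw [← LieSubmodule.mem_bot (R := K) (L := H), ← hbot]
    exact h1
  have h3 : ⁅h, v⁆ = (c : K) • v := by
    rw [ht.h_eq_coroot hβ he hf, ← hc]
    exact (LieModule.mem_weightSpace _ _).mp hv (coroot β.1)
  -- If `f` kills `v`, then `v` is primitive for the opposite triple with weight `-c`; but such a
  -- weight is a natural number.
  have hP : ht.symm.HasPrimitiveVectorWith v (-(c : K)) :=
    ⟨hv0, by rw [neg_lie, h3, neg_smul], h2⟩
  obtain ⟨m, hm⟩ := hP.exists_nat
  have h4 : ((m + c : ℕ) : K) = 0 := by rw [Nat.cast_add, ← hm]; ring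
  have := Nat.cast_eq_zero.mp h4
  omega

end LieModuleWeights

end LieModules

/-! ### Comparing the group with its Lie algebra -/

section Weights

open Filter Topology NormedSpace Module

namespace LinAlgGroup

attribute [local instance 100] LieRing.ofAssociativeRing

variable {n : ℕ} {G : Subgroup (GL (Fin n) ℂ)}
  {V : Type*} [AddCommGroup V] [Module ℂ V] [FiniteDimensional ℂ V] {ρ : Representation ℂ G V}
  (hG : IsZariskiClosed G) (hreg : IsRegularRep ρ)

/-- For each `φ` vanishing on `U`, all derivatives at 0 of the entire function `t ↦ φ (ρ (exp (t X))
v)` vanish. -/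
lemma apply_expG_mem {U : Submodule ℂ V}
    (hU : ∀ (X : lieAlg G), ∀ v ∈ U, differential hG hreg X v ∈ U) (X : lieAlg G) {v : V}
    (hv : v ∈ U) : ρ (expG hG X) v ∈ U := by
  rw [← Subspace.dualAnnihilator_dualCoannihilator_eq (W := U), Submodule.mem_dualCoannihilator]
  intro φ hφ
  rw [Submodule.mem_dualAnnihilator] at hφ
  let f : ℕ → ℂ → ℂ := fun k t => φ (ρ (expG hG (t • X)) ((differential hG hreg X ^ k) v))
  have hmem : ∀ k, (differential hG hreg X ^ k) v ∈ U := fun k => by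
    induction k with
    | zero => simpa using hv
    | succ k ih => rw [pow_succ']; exact hU X _ ih
  have hf : ∀ k t, HasDerivAt (f k) (f (k + 1) t) t := fun k t => by
    have := hasDerivAt_coeff hG hreg X ((differential hG hreg X ^ k) v) φ t
    simp only [f, pow_succ']
    exact this
  have h0 : ∀ k, f k 0 = 0 := fun k => by
    simp only [f, zero_smul, expG_zero, map_one]
    exact hφ _ (hmem k)
  simpa [f] using eq_zero_of_forall_hasDerivAt_succ hf h0 1

/-- A subspace that is invariant under the Lie algebra of a connected group is invariant under the
group. -/
lemma apply_mem_of_differential_mem (hconn : IsConnected (G : Set (GL (Fin n) ℂ)))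
    {U : Submodule ℂ V} (hU : ∀ (X : lieAlg G), ∀ v ∈ U, differential hG hreg X v ∈ U) (g : G)
    {v : V} (hv : v ∈ U) : ρ g v ∈ U := by
  -- The equivalence in the carrier, rather than an implication, makes closure under inverses
  -- immediate.
  let Δ : Subgroup G :=
    { carrier := {g | ∀ v, ρ g v ∈ U ↔ v ∈ U}
      one_mem' := by simp
      mul_mem' := fun {g h} hg hh v => by rw [map_mul]; exact (hg _).trans (hh v)
      inv_mem' := fun {g} hg v => by
        rw [← hg, ← Module.End.mul_apply, ← map_mul, mul_inv_cancel, map_one]; rfl }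
  have hle : G ≤ Δ.map G.subtype := le_of_expGL_mem hG hconn fun X hX => by
    refine ⟨expG hG ⟨X, hX⟩, fun v => ⟨fun h => ?_, fun h => apply_expG_mem hG hreg hU _ h⟩, rfl⟩
    have := apply_expG_mem hG hreg hU (-⟨X, hX⟩) h
    rwa [expG_neg, ← Module.End.mul_apply, ← map_mul, inv_mul_cancel, map_one] at this
  obtain ⟨g', hg', h⟩ := hle g.2
  obtain rfl : g' = g := Subtype.ext h
  exact (hg' v).mpr hv

lemma eq_bot_or_eq_top_of_differential_mem (hconn : IsConnected (G : Set (GL (Fin n) ℂ)))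
    (hirr : ρ.IsIrreducible) (U : Submodule ℂ V)
    (hU : ∀ (X : lieAlg G), ∀ v ∈ U, differential hG hreg X v ∈ U) : U = ⊥ ∨ U = ⊤ := by
  have : IsSimpleOrder (Subrepresentation ρ) := hirr
  rcases eq_bot_or_eq_top
    (⟨U, fun g v hv => apply_mem_of_differential_mem hG hreg hconn hU g hv⟩ :
      Subrepresentation ρ) with h | h
  · exact Or.inl (congrArg Subrepresentation.toSubmodule h)
  · exact Or.inr (congrArg Subrepresentation.toSubmodule h)

lemma apply_expG_eq_of_differential_eq {X : lieAlg G} {v : V} {c : ℂ}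
    (h : differential hG hreg X v = c • v) : ρ (expG hG X) v = Complex.exp c • v := by
  refine eq_of_forall_dual_apply_eq ℂ fun φ => ?_
  -- Multiplication by `exp (-t c)` makes the function constant.
  let f : ℂ → ℂ := fun t => φ (ρ (expG hG (t • X)) v) * Complex.exp (-(t * c))
  have hf : ∀ t, HasDerivAt f 0 t := fun t => by
    have h1 := hasDerivAt_coeff hG hreg X v φ t
    have h2 := ((hasDerivAt_id t).mul_const c).neg.cexp
    refine (h1.mul h2).congr_deriv ?_
    rw [h]
    simp
    ring
  have h1 := is_const_of_deriv_eq_zero (fun t => (hf t).differentiableAt) (fun t => (hf t).deriv) 1 0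
  have h2 : φ (ρ (expG hG X) v) * Complex.exp (-c) = φ v := by
    simpa [f, expG_zero] using h1
  rw [map_smul, ← h2, smul_eq_mul, mul_comm, mul_assoc, ← Complex.exp_add]
  simp

variable {H : Subgroup G}

lemma coe_mem_lieAlg_map (X : lieSub H) :
    ((X : lieAlg G) : Matrix (Fin n) (Fin n) ℂ) ∈ lieAlg (H.map G.subtype) := X.2

lemma expG_mem (hH : IsZariskiClosed (H.map G.subtype)) (X : lieSub H) : expG hG X ∈ H := by
  obtain ⟨h, hh, h'⟩ := expGL_mem hH (coe_mem_lieAlg_map X)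
  obtain rfl : h = expG hG X := Subtype.ext h'
  exact hh

lemma mem_weightSpace_iff (hH : IsZariskiClosed (H.map G.subtype))
    (μ : Dual ℂ (lieSub H)) (v : V) :
    v ∈ weightSpace ρ H μ ↔ ∀ X : lieSub H, differential hG hreg X v = μ X • v := by
  constructor
  · intro hv X
    refine differential_eq_of_hasDerivAt hG hreg fun φ => ?_
    have h1 : ∀ t : ℂ, ρ (expG hG (t • (X : lieAlg G))) v = Complex.exp (t * μ X) • v := fun t => by
      have := hv _ (expG_mem hG hH (t • X)) (t • X) rfl
      rw [map_smul] at this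
      exact this
    have h2 : HasDerivAt (fun t : ℂ => Complex.exp (t * μ X) * φ v) (μ X * φ v) 0 := by
      simpa using (((hasDerivAt_id (0 : ℂ)).mul_const (μ X)).cexp).mul_const (φ v)
    simpa [h1] using h2
  · intro hv h _ X hX
    obtain rfl : h = expG hG X := Subtype.ext (Units.ext hX)
    exact apply_expG_eq_of_differential_eq hG hreg (hv X)

variable [LieAlgebra.IsSimple ℂ (lieAlg G)]

/-- A Cartan subalgebra of a simple Lie algebra is abelian, so the connected group `H` is the image
of its exponential map. -/
lemma exists_expG_eq [hH : IsCartanSubgroup H] {h : G} (hh : h ∈ H) :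
    ∃ X : lieSub H, h = expG hG X := by
  have hconn : IsConnected ((H.map G.subtype : Subgroup (GL (Fin n) ℂ)) : Set (GL (Fin n) ℂ)) :=
    hH.isConnected.image _ continuous_subtype_val.continuousOn
  have hle : ∀ X ∈ lieAlg (H.map G.subtype), X ∈ lieAlg G := fun X hX p hp =>
    hX p fun g hg => by
      obtain ⟨g', -, rfl⟩ := hg
      exact hp _ g'.2
  have hcomm : ∀ X ∈ lieAlg (H.map G.subtype), ∀ Y ∈ lieAlg (H.map G.subtype), Commute X Y := by
    intro X hX Y hY
    have h1 := LieModule.IsTrivial.trivial (⟨⟨X, hle X hX⟩, hX⟩ : lieSub H)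
      (⟨⟨Y, hle Y hY⟩, hY⟩ : lieSub H)
    have h2 : ⁅X, Y⁆ = 0 := congrArg (fun Z : lieSub H => Z.1.1) h1
    rwa [LieRing.of_associative_ring_bracket, sub_eq_zero] at h2
  obtain ⟨X, hX, h'⟩ := exists_expGL_eq_of_commute hH.isZariskiClosed hconn hcomm ⟨h, hh, rfl⟩
  exact ⟨⟨⟨X, hle X hX⟩, hX⟩, Subtype.ext h'⟩

omit [FiniteDimensional ℂ V] in
lemma mem_invariants_iff (hG : IsZariskiClosed G) [hH : IsCartanSubgroup H] (v : V) :
    v ∈ Representation.invariants (ρ.comp H.subtype) ↔ v ∈ weightSpace ρ H 0 := by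
  constructor
  · intro hv h hh X _
    simpa using hv ⟨h, hh⟩
  · rintro hv ⟨h, hh⟩
    obtain ⟨X, rfl⟩ := exists_expG_eq hG hh
    simpa using hv _ hh X rfl

end LinAlgGroup

end Weights

/-! ### The weights of `ρ` and the torus of short roots -/

section Torus

open Module LieAlgebra LieAlgebra.IsKilling

namespace LinAlgGroup

attribute [local instance 100] LieRing.ofAssociativeRing

variable {n : ℕ} {G : Subgroup (GL (Fin n) ℂ)}
  {V : Type*} [AddCommGroup V] [Module ℂ V] [FiniteDimensional ℂ V] {ρ : Representation ℂ G V}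
  (hG : IsZariskiClosed G) (hreg : IsRegularRep ρ)

/-- The differential of a representation, as a homomorphism of Lie algebras. -/
noncomputable def lieDifferential : lieAlg G →ₗ⁅ℂ⁆ End ℂ V where
  toLinearMap := differential hG hreg
  map_lie' := differential_lie hG hreg _ _

variable [LieAlgebra.IsSimple ℂ (lieAlg G)] (H : Subgroup G) [hH : IsCartanSubgroup H]

include hG hreg

omit [LieAlgebra.IsSimple ℂ (lieAlg G)] in
lemma weightSpace_eq_comp (μ : Dual ℂ (lieSub H)) :
    letI := LieRingModule.compLieHom V (lieDifferential hG hreg)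
    letI := LieModule.compLieHom V (lieDifferential hG hreg)
    (LieModule.weightSpace V (μ : lieSub H → ℂ)).toSubmodule = weightSpace ρ H μ := by
  let := LieRingModule.compLieHom V (lieDifferential hG hreg)
  let := LieModule.compLieHom V (lieDifferential hG hreg)
  ext v
  rw [mem_weightSpace_iff hG hreg hH.isZariskiClosed, LieSubmodule.mem_toSubmodule,
    LieModule.mem_weightSpace]
  rfl

omit [LieAlgebra.IsSimple ℂ (lieAlg G)] in
lemma mem_weights_iff_comp (μ : Dual ℂ (lieSub H)) :
    letI := LieRingModule.compLieHom V (lieDifferential hG hreg)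
    letI := LieModule.compLieHom V (lieDifferential hG hreg)
    μ ∈ weights ρ H ↔ LieModule.weightSpace V (μ : lieSub H → ℂ) ≠ ⊥ := by
  let := LieRingModule.compLieHom V (lieDifferential hG hreg)
  let := LieModule.compLieHom V (lieDifferential hG hreg)
  rw [ne_eq, ← LieSubmodule.toSubmodule_eq_bot, weightSpace_eq_comp hG hreg H μ]
  rfl

lemma iSup_weightSpace_eq_top_of_isIrreducible [Nontrivial V]
    (hconn : IsConnected (G : Set (GL (Fin n) ℂ)))
    (hirr : ρ.IsIrreducible) : ⨆ μ : Dual ℂ (lieSub H), weightSpace ρ H μ = ⊤ := by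
  let := LieRingModule.compLieHom V (lieDifferential hG hreg)
  let := LieModule.compLieHom V (lieDifferential hG hreg)
  simp_rw [← weightSpace_eq_comp hG hreg H]
  exact iSup_weightSpace_eq_top (lieSub H)
    (eq_bot_or_eq_top_of_differential_mem hG hreg hconn hirr)

lemma exists_root_mem_weights (hconn : IsConnected (G : Set (GL (Fin n) ℂ)))
    (hirr : ρ.IsIrreducible) (h0 : 0 ∈ weights ρ H) (h1 : weightSpace ρ H 0 ≠ ⊤) :
    ∃ i, (rootSys H).root i ∈ weights ρ H := by
  let := LieRingModule.compLieHom V (lieDifferential hG hreg)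
  let := LieModule.compLieHom V (lieDifferential hG hreg)
  rw [mem_weights_iff_comp hG hreg H] at h0
  rw [← weightSpace_eq_comp hG hreg H, ne_eq, LieSubmodule.toSubmodule_eq_top] at h1
  obtain ⟨i, hi⟩ := exists_root_weightSpace_ne_bot (lieSub H)
    (eq_bot_or_eq_top_of_differential_mem hG hreg hconn hirr) h0 h1
  exact ⟨i, (mem_weights_iff_comp hG hreg H _).mpr hi⟩

lemma root_sub_root_mem_weights {i j : (lieSub H).root} (hi : (rootSys H).root i ∈ weights ρ H)
    (hij : 0 < (rootSys H).pairingIn ℤ i j) :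
    (rootSys H).root i - (rootSys H).root j ∈ weights ρ H := by
  let := LieRingModule.compLieHom V (lieDifferential hG hreg)
  let := LieModule.compLieHom V (lieDifferential hG hreg)
  rw [mem_weights_iff_comp hG hreg H] at hi ⊢
  obtain ⟨c, hc⟩ := Int.eq_ofNat_of_zero_le hij.le
  have h1 : (i.1 : lieSub H → ℂ) (coroot j.1) = c := by
    have := (rootSys H).algebraMap_pairingIn ℤ i j
    rw [hc] at this
    simpa using this.symm
  have h2 := weightSpace_sub_root_ne_bot (lieSub H) j h1 (by omega) hi
  have h3 : ⇑((rootSys H).root i - (rootSys H).root j) = -⇑(j.1.toLinear) + ⇑i.1 := by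
    funext X
    simp [sub_eq_neg_add]
  rwa [h3]

/-- It suffices that one short root is a weight, since all other nonzero weights are conjugate to
it. -/
lemma eq_zero_or_mem_shortRoots_of_mem_weights (hconn : IsConnected (G : Set (GL (Fin n) ℂ)))
    (hirr : ρ.IsIrreducible) (hρ : IsProperlyQuasiMinuscule ρ H) {μ : Dual ℂ (lieSub H)}
    (hμ : μ ∈ weights ρ H) : μ = 0 ∨ μ ∈ shortRoots H := by
  obtain ⟨hq, hm⟩ := hρ
  -- Two non-conjugate weights are neither both nonzero nor both zero.
  obtain ⟨h0, ν, hν, hν0⟩ : 0 ∈ weights ρ H ∧ ∃ ν ∈ weights ρ H, ν ≠ 0 := by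
    unfold IsMinuscule at hm
    push Not at hm
    obtain ⟨μ₁, h₁, μ₂, h₂, hne⟩ := hm
    by_cases hz₁ : μ₁ = 0
    · refine ⟨hz₁ ▸ h₁, μ₂, h₂, fun hz₂ => hne 1 ?_⟩
      rw [one_smul, hz₁, hz₂]
    · refine ⟨?_, μ₁, h₁, hz₁⟩
      by_contra h
      have hz₂ : μ₂ ≠ 0 := fun hz => h (hz ▸ h₂)
      obtain ⟨w, hw⟩ := hq μ₁ h₁ hz₁ μ₂ h₂ hz₂
      exact hne w hw
  have h1 : weightSpace ρ H 0 ≠ ⊤ := fun htop => by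
    obtain ⟨v, hv, hv0⟩ := Submodule.exists_mem_ne_zero_of_ne_bot hν
    refine hν0 (LinearMap.ext fun X => ?_)
    have h2 := (mem_weightSpace_iff hG hreg hH.isZariskiClosed ν v).mp hv X
    have h3 := (mem_weightSpace_iff hG hreg hH.isZariskiClosed 0 v).mp (htop ▸ trivial) X
    rw [h3, eq_comm, LinearMap.zero_apply, zero_smul] at h2
    exact (smul_eq_zero.mp h2).resolve_right hv0
  obtain ⟨i, hi⟩ := exists_root_mem_weights hG hreg H hconn hirr h0 h1
  have hi0 : (rootSys H).root i ≠ 0 := (rootSys H).ne_zero i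
  have hshort : (rootSys H).root i ∈ shortRoots H := by
    by_contra hns
    obtain ⟨j, -, hij, hγ⟩ := exists_shortRoot_sub_shortRoot H i hns
    have hγ0 : (rootSys H).root i - (rootSys H).root j ≠ 0 := by
      obtain ⟨k, hk, -⟩ := hγ
      exact hk ▸ (rootSys H).ne_zero k
    -- The short root `i - j` is a weight, hence conjugate to the supposedly long weight `i`.
    obtain ⟨w, hw⟩ := hq _ (root_sub_root_mem_weights hG hreg H hi hij) hγ0 _ hi hi0
    exact hns (hw ▸ weylGroup_smul_mem_shortRoots H w hγ)
  by_cases hμ0 : μ = 0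
  · exact Or.inl hμ0
  · obtain ⟨w, hw⟩ := hq _ hi hi0 μ hμ hμ0
    exact Or.inr (hw ▸ weylGroup_smul_mem_shortRoots H w hshort)

omit [FiniteDimensional ℂ V] hreg in
lemma map_le_shortRootTorus : H.map ρ.asGroupHom ≤ shortRootTorus ρ H := by
  rintro _ ⟨h, hh, rfl⟩
  obtain ⟨X, rfl⟩ := exists_expG_eq hG hh
  refine ⟨fun v hv => hv ⟨_, hh⟩,
    fun α => Units.mk0 (Complex.exp (α.1 X)) (Complex.exp_ne_zero _),
    fun α v hv => hv _ hh X rfl, fun α β h => Units.ext ?_, fun α β γ h => Units.ext ?_⟩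
  · simp [h, ← Complex.exp_add]
  · have h1 : α.1 X + β.1 X + γ.1 X = 0 := LinearMap.congr_fun h X
    simp [← Complex.exp_add, h1]

lemma shortRootTorus_le_map (hconn : IsConnected (G : Set (GL (Fin n) ℂ)))
    (hirr : ρ.IsIrreducible) (hρ : IsProperlyQuasiMinuscule ρ H) :
    shortRootTorus ρ H ≤ H.map ρ.asGroupHom := by
  have : IsSimpleOrder (Subrepresentation ρ) := hirr
  have : Nontrivial V := by
    by_contra hV
    rw [not_nontrivial_iff_subsingleton] at hV
    exact bot_ne_top (α := Subrepresentation ρ)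
      (Subrepresentation.toSubmodule_injective (Subsingleton.elim _ _))
  rintro A ⟨hA0, a, ha, ha₁, ha₂⟩
  obtain ⟨X, hX⟩ := exists_exp_eq_of_shortRoots H a ha₁ ha₂
  have hmem := expG_mem hG hH.isZariskiClosed X
  refine ⟨expG hG X, hmem, Units.ext (LinearMap.ext fun v => ?_)⟩
  have hv : v ∈ ⨆ μ : Dual ℂ (lieSub H), weightSpace ρ H μ := by
    rw [iSup_weightSpace_eq_top_of_isIrreducible hG hreg H hconn hirr]
    trivial
  -- `ρ (exp X)` and `A` are compared on each weight space; only 0 and short roots contribute.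
  refine Submodule.iSup_induction _ (motive := fun v => ρ (expG hG X) v = A.1 v) hv
    (fun μ v hv => ?_) (by simp) fun v w hv hw => by rw [map_add, map_add, hv, hw]
  by_cases hμ : μ ∈ weights ρ H
  · rcases eq_zero_or_mem_shortRoots_of_mem_weights hG hreg H hconn hirr hρ hμ with rfl | hs
    · have hv' := (mem_invariants_iff hG v).mpr hv
      rw [hA0 v hv']
      exact hv' ⟨_, hmem⟩
    · rw [ha ⟨μ, hs⟩ v hv, hv _ hmem X rfl, ← hX ⟨μ, hs⟩]
  · have h0 : weightSpace ρ H μ = ⊥ := not_not.mp hμ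
    rw [h0, Submodule.mem_bot] at hv
    rw [hv, map_zero, map_zero]

end LinAlgGroup

end Torus

theorem mainTheorem5 {n : ℕ} (G : Subgroup (Matrix.GeneralLinearGroup (Fin n) ℂ))
    (hG : LinAlgGroup.IsZariskiClosed G) [SimplyConnectedSpace G]
    [LieAlgebra.IsSimple ℂ (LinAlgGroup.lieAlg G)]
    (H : Subgroup G) [LinAlgGroup.IsCartanSubgroup H]
    {V : Type*} [AddCommGroup V] [Module ℂ V] [FiniteDimensional ℂ V]
    (ρ : Representation ℂ G V) (hreg : LinAlgGroup.IsRegularRep ρ)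
    (hirr : ρ.IsIrreducible) (hρ : LinAlgGroup.IsProperlyQuasiMinuscule ρ H) :
    H.map ρ.asGroupHom = LinAlgGroup.shortRootTorus ρ H ∧
    LinearMap.ker (LinAlgGroup.shortRootMap H) =
      Submodule.span ℤ
        ({x | ∃ α β : LinAlgGroup.shortRoots H,
            (β : Module.Dual ℂ (LinAlgGroup.lieSub H)) = -α ∧
            x = Finsupp.single α 1 + Finsupp.single β 1} ∪
         {x | ∃ α β γ : LinAlgGroup.shortRoots H,
            (α + β : Module.Dual ℂ (LinAlgGroup.lieSub H)) = γ ∧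
            x = Finsupp.single α 1 + Finsupp.single β 1 - Finsupp.single γ 1}) := by
  -- Connectedness of `G` transfers irreducibility from the group to its Lie algebra.
  have hconn : IsConnected (G : Set (GL (Fin n) ℂ)) := isConnected_iff_connectedSpace.mpr
    inferInstance
  exact ⟨le_antisymm (LinAlgGroup.map_le_shortRootTorus hG H)
    (LinAlgGroup.shortRootTorus_le_map hG hreg H hconn hirr hρ),
    LinAlgGroup.ker_shortRootMap H⟩
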